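/- **Setting.** Let $\mathcal H$ be a separable real Hilbert space (of finite or infinite dimension), $n\in\mathbb N$, $G\in\mathcal B(\mathcal H,\mathbb R^n)$, let $\mathcal C_{obs}$ be a self-adjoint positive operator on $\mathbb R^n$ and $\mathcal C_{pr}>0$ a self-adjoint, positive (i.e. $\langle \mathcal C_{pr}h,h\rangle>0$ for $h\ne0$), trace-class operator on $\mathcal H$ (the covariance of a nondegenerate Gaussian prior for the linear model $Y=Gx+\zeta$, $\zeta\sim\mathcal N(0,\mathcal C_{obs})$). Put $H=G^*\mathcal C_{obs}^{-1}G$ and let $$\mathcal C_{pos}=\mathcal C_{pr}-\mathcal C_{pr}G^*(\mathcal C_{obs}+G\mathcal C_{pr}G^*)^{-1}G\mathcal C_{pr}$$ be the posterior covariance. Let $(\lambda_i)_{i\ge1}\subset(-1,0]$ be a nondecreasing sequence and $(w_i)_i\subset \operatorname{ran}\mathcal C_{pr}^{1/2}$ an orthonormal basis of $\mathcal H$ with $$\mathcal C_{pr}^{1/2}H\mathcal C_{pr}^{1/2}=\sum_i\frac{-\lambda_i}{1+\lambda_i}\,w_i\otimes w_i$$ (if $\dim\mathcal H<\infty$, put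 $\lambda_i=0$, $w_i=0$ for $i>\dim\mathcal H$). **Losses.** Let $\mathscr F$ be the set of $f\in C^1((-1,\infty))$ with $f(0)=0$, $xf'(x)>0$ for $x\neq0$, $\lim_{x\to\infty}f(x)=\infty$, and $f'$ Lipschitz at $0$ (there are $M,\varepsilon>0$ with $|f'(x)-f'(0)|\le M|x|$ for $|x|<\varepsilon$). Let $\mathcal E$ be the set of nonnegative trace-class $\mathcal C$ for which $A=\mathcal C^{-1/2}\mathcal C_{pos}^{1/2}$ is a well-defined, boundedly invertible operator on $\mathcal H$ with $AA^*-I$ Hilbert–Schmidt; by the Feldman–Hajek theorem these are the covariances of the Gaussian measures that have the posterior mean and are equivalent to the posterior. For $\mathcal C_1,\mathcal C_2\in\mathcal E$ and $f\in\mathscr F$ put $$R(\mathcal C_2\Vert\mathcal C_1)=\mathcal C_1^{-1/2}\mathcal C_2^{1/2}\,(\mathcal C_1^{-1/2}\mathcal C_2^{1/2})^*-I,\qquad \mathcal L_f(\mathcal C_2\Vert\mathcal C_1)=\sum_i f\big(\Lambda_i(R(\mathcal C_2\Vert\mathcal C_1))\big),$$ where $(\Lambda_i(\cdot))_i$ are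 the eigenvalues counted with multiplicity. **Approximation classes.** For $r\ge0$ let $$\mathscr C_r=\{\mathcal C_{pr}-KK^*>0:\ K\in\mathcal B(\mathbb R^r,\mathcal H),\ \operatorname{ran}K\subset\operatorname{ran}\mathcal C_{pr}\},\qquad \mathscr P_r=\{\mathcal C_{pr}^{-1}+UU^*:\ U\in\mathcal B(\mathbb R^r,\mathcal H)\},$$ the elements of $\mathscr P_r$ being operators with domain $\operatorname{ran}\mathcal C_{pr}$. **Theorem.** Let $0\le r\le n$ and $$\mathcal P_r^{opt}=\mathcal C_{pr}^{-1}+\sum_{i=1}^r\frac{-\lambda_i}{1+\lambda_i}\,\mathcal C_{pr}^{-1/2}w_i\otimes\mathcal C_{pr}^{-1/2}w_i,\qquad \mathcal C_r^{opt}=\mathcal C_{pr}-\sum_{i=1}^r(-\lambda_i)\,\mathcal C_{pr}^{1/2}w_i\otimes\mathcal C_{pr}^{1/2}w_i .$$ 1. The minimisation problems below are well posed: $\mathcal C_{pos}\in\mathcal E$ and $\mathscr C_r\subset\mathcal E$; every $\mathcal P\in\mathscr P_r$ is injective with a bounded, everywhere defined inverse $\mathcal P^{-1}\in\mathcal E$;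 and the sums defining $\mathcal L_f(\mathcal C_{pos}\Vert\mathcal C)$, $\mathcal C\in\mathscr C_r$, and $\mathcal L_f(\mathcal C_{pos}\Vert\mathcal P^{-1})$, $\mathcal P\in\mathscr P_r$, converge for every $f\in\mathscr F$. 2. $\mathcal P_r^{opt}\in\mathscr P_r$, and for every $f\in\mathscr F$ it minimises $\mathcal P\mapsto\mathcal L_f(\mathcal C_{pos}\Vert\mathcal P^{-1})$ over $\mathscr P_r$. Likewise $\mathcal C_r^{opt}\in\mathscr C_r$, and for every $f\in\mathscr F$ it minimises $\mathcal C\mapsto\mathcal L_f(\mathcal C_{pos}\Vert\mathcal C)$ over $\mathscr C_r$. 3. $\mathcal P_r^{opt}$ and $\mathcal C_r^{opt}$ are inverses of each other. 4. For every $f\in\mathscr F$ the minimal loss is $\mathcal L_f(\mathcal C_{pos}\Vert\mathcal C_r^{opt})=\sum_{i>r}f(\lambda_i)$. 5. $\mathcal C_r^{opt}$ is the only element of $\mathscr C_r$, and $\mathcal P_r^{opt}$ the only element of $\mathscr P_r$, that is optimal for all $f\in\mathscr F$ simultaneously, if and only if $r=0$ or $\lambda_r=0$ or $\lambda_r<\lambda_{r+1}$.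 The same criterion characterises uniqueness of the minimiser over $\mathscr C_r$, and over $\mathscr P_r$, for each single $f\in\mathscr F$. -/

import Mathlib

noncomputable section

namespace LowRankGaussian

open ContinuousLinearMap

variable {H : Type*} [NormedAddCommGroup H] [InnerProductSpace ℝ H]

/-! ### Operators on a real Hilbert space -/

section Operators

/-- `T > 0`: bounded, self-adjoint and `⟨T h, h⟩ > 0` for every `h ≠ 0` (equivalently:
nonnegative and injective). -/
def IsStrictlyPos [CompleteSpace H] (T : H →L[ℝ] H) : Prop :=
  IsSelfAdjoint T ∧ ∀ h : H, h ≠ 0 → 0 < inner ℝ (T h) h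

/-- Trace-class condition for a *nonnegative* operator: the sum `∑ ⟨T bᵢ, bᵢ⟩` over an orthonormal
basis is finite (the value does not depend on the basis). It is only used together with
nonnegativity. -/
def HasFiniteTrace (T : H →L[ℝ] H) : Prop :=
  ∃ (ι : Type) (b : HilbertBasis ι ℝ H), Summable fun i => inner ℝ (T (b i)) (b i)

/-- Hilbert--Schmidt operators: `∑ ‖T bᵢ‖² < ∞` over an orthonormal basis (the value does not
depend on the basis). -/
def IsHilbertSchmidt (T : H →L[ℝ] H) : Prop :=
  ∃ (ι : Type) (b : HilbertBasis ι ℝ H), Summable fun i => ‖T (b i)‖ ^ 2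

open Classical in
/-- The nonnegative self-adjoint square root `T^{1/2}` of a nonnegative operator `T` (it exists and
is unique; the value is `0` when there is none). -/
def opSqrt (T : H →L[ℝ] H) : H →L[ℝ] H :=
  if h : ∃ S : H →L[ℝ] H, S.IsPositive ∧ S ∘L S = T then h.choose else 0

/-- A bounded operator seen as a possibly unbounded operator with domain the whole space. -/
def toUnbdd (T : H →L[ℝ] H) : H →ₗ.[ℝ] H :=
  (T : H →ₗ[ℝ] H).toPMap ⊤

open Classical in
/-- For a possibly unbounded operator `P` whose inverse is bounded and defined everywhere: this
inverse as a bounded operator (the value is `0` when there is none). -/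
def boundedInverse (P : H →ₗ.[ℝ] H) : H →L[ℝ] H :=
  if h : ∃ T : H →L[ℝ] H, P.inverse = toUnbdd T then h.choose else 0

/-- `T^{-1/2} x` for injective `T > 0` and `x` in the range of `T^{1/2}`: the vector `y` with
`T^{1/2} y = x`. -/
def invSqrtApply (T : H →L[ℝ] H) (x : H) : H :=
  Function.invFun (opSqrt T) x

open Classical in
/-- The bounded operator `C₁^{-1/2} C₂^{1/2}`, i.e. the (for injective `C₁` unique) bounded `A` with
`C₁^{1/2} A = C₂^{1/2}`; the value is `0` when there is none. -/
def invSqrtMulSqrt (C₁ C₂ : H →L[ℝ] H) : H →L[ℝ] H :=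
  if h : ∃ A : H →L[ℝ] H, opSqrt C₁ ∘L A = opSqrt C₂ then h.choose else 0

/-- `A` is boundedly invertible and `A A* - I` is Hilbert--Schmidt. -/
def PropertyE [CompleteSpace H] (A : H →L[ℝ] H) : Prop :=
  IsUnit A ∧ IsHilbertSchmidt (A ∘L adjoint A - 1)

/-- `w 0, w 1, …` is an orthonormal basis of the separable Hilbert space `H`, listed as a sequence;
if `H` has finite dimension `d` then the list is continued by `w i = 0` for `i ≥ d`. -/
structure IsONBSeq (w : ℕ → H) : Prop where
  orthonormal : Orthonormal ℝ (fun i : {i : ℕ // w i ≠ 0} => w i)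
  dense : (Submodule.span ℝ (Set.range w)).topologicalClosure = ⊤
  initial : ∀ i j, i ≤ j → w i = 0 → w j = 0

end Operators

/-! ### The linear Gaussian inverse problem `Y = G x + ζ` -/

section Model

variable [CompleteSpace H] {n : ℕ}

/-- The Hessian `G* C_obs⁻¹ G` of the negative log-likelihood. -/
def hessian (G : H →L[ℝ] EuclideanSpace ℝ (Fin n))
    (Cobs : EuclideanSpace ℝ (Fin n) →L[ℝ] EuclideanSpace ℝ (Fin n)) : H →L[ℝ] H :=
  adjoint G ∘L Ring.inverse Cobs ∘L G

/-- The posterior covariance `C_pr - C_pr G* (C_obs + G C_pr G*)⁻¹ G C_pr`. -/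
def posteriorCov (G : H →L[ℝ] EuclideanSpace ℝ (Fin n))
    (Cobs : EuclideanSpace ℝ (Fin n) →L[ℝ] EuclideanSpace ℝ (Fin n)) (Cpr : H →L[ℝ] H) :
    H →L[ℝ] H :=
  Cpr - Cpr ∘L adjoint G ∘L Ring.inverse (Cobs + G ∘L Cpr ∘L adjoint G) ∘L G ∘L Cpr

/-- The eigenvalues `lam` and eigenvectors `w` of the model: `lam` is an increasing sequence in
`(-1, 0]`, `w` is an orthonormal basis of `H` contained in the range of `C_pr^{1/2}`, and
`C_pr^{1/2} (G* C_obs⁻¹ G) C_pr^{1/2} = ∑ᵢ (-lamᵢ / (1 + lamᵢ)) wᵢ ⊗ wᵢ`.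
Indices start at `0`; for `dim H = d < ∞` both sequences are continued by zeros. -/
structure IsEigenSystem (G : H →L[ℝ] EuclideanSpace ℝ (Fin n))
    (Cobs : EuclideanSpace ℝ (Fin n) →L[ℝ] EuclideanSpace ℝ (Fin n)) (Cpr : H →L[ℝ] H)
    (lam : ℕ → ℝ) (w : ℕ → H) : Prop where
  mono : Monotone lam
  mem_Ioc : ∀ i, lam i ∈ Set.Ioc (-1 : ℝ) 0
  onb : IsONBSeq w
  pad : ∀ i, w i = 0 → lam i = 0
  mem_range : ∀ i, w i ∈ Set.range (opSqrt Cpr)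
  hasSum : ∀ h : H, HasSum
    (fun i => (-lam i / (1 + lam i)) • InnerProductSpace.rankOne ℝ (w i) (w i) h)
    ((opSqrt Cpr ∘L hessian G Cobs ∘L opSqrt Cpr) h)

end Model

/-! ### Spectral losses -/

section Loss

/-- The class of spectral functions: `f ∈ C¹((-1, ∞))`, `f 0 = 0`, `x f'(x) > 0` for `x ≠ 0`,
`f(x) → ∞` as `x → ∞`, and `f'` is Lipschitz at `0`. Values of `f` outside `(-1, ∞)` are
irrelevant. -/
def spectralFunctions : Set (ℝ → ℝ) :=
  {f | ContDiffOn ℝ 1 f (Set.Ioi (-1)) ∧ f 0 = 0 ∧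
    (∀ x : ℝ, -1 < x → x ≠ 0 → 0 < x * deriv f x) ∧
    Filter.Tendsto f Filter.atTop Filter.atTop ∧
    ∃ M ε : ℝ, 0 < ε ∧ ∀ x : ℝ, |x| < ε → |deriv f x - deriv f 0| ≤ M * |x|}

variable [CompleteSpace H]

/-- The covariances `C` for which `N(m, C)` is equivalent to `N(m, C_pos)`, in the form given by the
Feldman--Hajek theorem: `C ≥ 0` is trace class and `C^{-1/2} C_pos^{1/2}` is a well-defined bounded
operator with property E. -/
def equivalentCovs (Cpos : H →L[ℝ] H) : Set (H →L[ℝ] H) :=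
  {C | C.IsPositive ∧ HasFiniteTrace C ∧
    ∃ A : H →L[ℝ] H, opSqrt C ∘L A = opSqrt Cpos ∧ PropertyE A}

/-- `R(C₂ ‖ C₁) = C₁^{-1/2} C₂^{1/2} (C₁^{-1/2} C₂^{1/2})* - I`. -/
def fhOperator (C₂ C₁ : H →L[ℝ] H) : H →L[ℝ] H :=
  invSqrtMulSqrt C₁ C₂ ∘L adjoint (invSqrtMulSqrt C₁ C₂) - 1

/-- The contribution of `μ` to `∑ᵢ f(Λᵢ(R(C₂ ‖ C₁)))`, the sum over the eigenvalues counted with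
multiplicity: the multiplicity of `μ` times `f μ`. (An infinite-dimensional eigenspace of a
Hilbert--Schmidt operator can only belong to `μ = 0`, where `f` vanishes.) -/
def lossTerm (f : ℝ → ℝ) (C₂ C₁ : H →L[ℝ] H) (μ : ℝ) : ℝ :=
  (Module.finrank ℝ (Module.End.eigenspace (fhOperator C₂ C₁ : H →ₗ[ℝ] H) μ) : ℝ) * f μ

/-- The spectral loss `L_f(C₂ ‖ C₁) = ∑ᵢ f(Λᵢ(R(C₂ ‖ C₁)))`. -/
def spectralLoss (f : ℝ → ℝ) (C₂ C₁ : H →L[ℝ] H) : ℝ :=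
  ∑' μ : ℝ, lossTerm f C₂ C₁ μ

end Loss

/-! ### Approximation classes and approximation problems -/

section Problems

variable [CompleteSpace H]

/-- `{C_pr - K K* > 0 : K ∈ B(ℝʳ, H), ran K ⊆ ran C_pr}`. -/
def covClass (Cpr : H →L[ℝ] H) (r : ℕ) : Set (H →L[ℝ] H) :=
  {C | ∃ K : EuclideanSpace ℝ (Fin r) →L[ℝ] H,
    Set.range K ⊆ Set.range Cpr ∧ C = Cpr - K ∘L adjoint K ∧ IsStrictlyPos C}

/-- `{C_pr⁻¹ + U U* : U ∈ B(ℝʳ, H)}`, a set of (for `dim H = ∞`) unbounded operators with domain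
`ran C_pr`. -/
def precClass (Cpr : H →L[ℝ] H) (r : ℕ) : Set (H →ₗ.[ℝ] H) :=
  {P | ∃ U : EuclideanSpace ℝ (Fin r) →L[ℝ] H,
    P = (toUnbdd Cpr).inverse + toUnbdd (U ∘L adjoint U)}

/-- `C ∈ 𝒞` minimises `L_f(C_pos ‖ ·)` over the set `𝒞` of covariances. -/
def MinimisesCov (f : ℝ → ℝ) (Cpos : H →L[ℝ] H) (𝒞 : Set (H →L[ℝ] H)) (C : H →L[ℝ] H) : Prop :=
  C ∈ 𝒞 ∧ IsMinOn (fun C' => spectralLoss f Cpos C') 𝒞 C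

/-- `P ∈ 𝒬` minimises `L_f(C_pos ‖ (·)⁻¹)` over the set `𝒬` of precisions. -/
def MinimisesPrec (f : ℝ → ℝ) (Cpos : H →L[ℝ] H) (𝒬 : Set (H →ₗ.[ℝ] H)) (P : H →ₗ.[ℝ] H) :
    Prop :=
  P ∈ 𝒬 ∧ IsMinOn (fun P' => spectralLoss f Cpos (boundedInverse P')) 𝒬 P

/-- `C` is a minimiser for all spectral functions simultaneously. -/
def SolvesCov (Cpos : H →L[ℝ] H) (𝒞 : Set (H →L[ℝ] H)) (C : H →L[ℝ] H) : Prop :=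
  C ∈ 𝒞 ∧ ∀ f ∈ spectralFunctions, MinimisesCov f Cpos 𝒞 C

/-- `P` is a minimiser for all spectral functions simultaneously. -/
def SolvesPrec (Cpos : H →L[ℝ] H) (𝒬 : Set (H →ₗ.[ℝ] H)) (P : H →ₗ.[ℝ] H) : Prop :=
  P ∈ 𝒬 ∧ ∀ f ∈ spectralFunctions, MinimisesPrec f Cpos 𝒬 P

/-- `C_r^opt = C_pr - ∑_{i < r} (-lamᵢ) C_pr^{1/2} wᵢ ⊗ C_pr^{1/2} wᵢ` (indices from `0`). -/
def covOpt (Cpr : H →L[ℝ] H) (lam : ℕ → ℝ) (w : ℕ → H) (r : ℕ) : H →L[ℝ] H :=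
  Cpr - ∑ i ∈ Finset.range r,
    (-lam i) • InnerProductSpace.rankOne ℝ (opSqrt Cpr (w i)) (opSqrt Cpr (w i))

/-- `P_r^opt = C_pr⁻¹ + ∑_{i < r} (-lamᵢ / (1 + lamᵢ)) C_pr^{-1/2} wᵢ ⊗ C_pr^{-1/2} wᵢ`
(indices from `0`). -/
def precOpt (Cpr : H →L[ℝ] H) (lam : ℕ → ℝ) (w : ℕ → H) (r : ℕ) : H →ₗ.[ℝ] H :=
  (toUnbdd Cpr).inverse + toUnbdd (∑ i ∈ Finset.range r,
    (-lam i / (1 + lam i)) •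
      InnerProductSpace.rankOne ℝ (invSqrtApply Cpr (w i)) (invSqrtApply Cpr (w i)))

end Problems

end LowRankGaussian

end

open LowRankGaussian

/-!
Let `S = C_pr^{1/2}` and `Λ = ∑ λᵢ wᵢ ⊗ wᵢ`, which has finite rank because the Hessian factors through
`ℝⁿ`. The Woodbury identity gives `C_pos = S (1 + Λ) S` (`posteriorCov_eq`). It also shows that
inversion identifies the two approximation classes: their elements are
`P = C_pr⁻¹ + U U*` and `P⁻¹ = S (1 + S U U* S)⁻¹ S`, with the same operators `U : ℝʳ → H`
(`precision_inverse`, `lowRankCov_mem_covClass`, `exists_lowRankCov_of_mem_covClass`). The condition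
`ran K ⊆ ran C_pr` is what makes `1 - L L*` invertible in `C_pr - K K* = S (1 - L L*) S`.

By polar decomposition of `S (1 + S U U* S)^{-1/2}` and `S (1 + Λ)^{1/2}`, the operator `R(C_pos ‖ P⁻¹)`
is similar to the self-adjoint finite-rank operator `Λ + N N*` with `N = (1 + Λ)^{1/2} S U`
(`exists_sqrt_quotient`, `SpectralData.relOp_eq`), so the loss is the sum of `f` over its eigenvalues
`μ₀ ≤ μ₁ ≤ …`. Weyl's inequality `μᵢ ≤ λ_{r+i}` (`eigenvalue_le_of_lowRankPert`) and the monotonicity of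
`f` on `(-1, 0]` bound the loss from below by `∑_{i ≥ r} f(λᵢ)`, and this value is attained when `N N*`
cancels `λ₀, …, λ_{r-1}`.

If a competitor attains the bound, then `μᵢ = λ_{r+i}` for all `i`. Comparing the traces of `Λ + N N*`
and of its compression to `ran N` gives equality in the Ky Fan inequality `kyFan_weights`. With a gap
between `λ_{r-1}` and `λ_r`, or with `λ_{r-1} = 0`, this forces `N N*` to be the optimal one
(`lowRankPert_eq_of_eigenvalues_eq`). Without a gap, exchanging `w_{r-1}` and `w_r` gives another
eigensystem, hence another solution (`IsEigenSystem.exists_other_solution`).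

Square roots of bounded positive operators on a real Hilbert space are obtained from a power series
(`exists_isPositive_sqrt`).
-/

noncomputable section

namespace LowRankGaussian

open ContinuousLinearMap

/-! ### Square roots of positive operators -/

theorem sum_range_catalan_div (N : ℕ) :
    ∑ k ∈ Finset.range N, (catalan k : ℝ) / 4 ^ k = 2 - 2 * (N.centralBinom : ℝ) / 4 ^ N := by
  induction N with
  | zero => simp
  | succ N ih =>
    rw [Finset.sum_range_succ, ih]
    have h1 : ((N : ℝ) + 1) * catalan N = N.centralBinom := by
      exact_mod_cast succ_mul_catalan_eq_centralBinom N
    have h2 : ((N : ℝ) + 1) * (N + 1).centralBinom = 2 * (2 * N + 1) * N.centralBinom := by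
      exact_mod_cast Nat.succ_mul_centralBinom_succ N
    have h0 : (N : ℝ) + 1 ≠ 0 := by positivity
    have h3 : ((N + 1).centralBinom : ℝ) = 2 * (2 * N + 1) * catalan N := by
      apply mul_left_cancel₀ h0
      rw [h2, ← h1]; ring
    rw [h3, ← h1, pow_succ]
    field_simp
    ring

theorem summable_catalan_div : Summable fun k : ℕ => (catalan k : ℝ) / 4 ^ k := by
  refine summable_of_sum_range_le (c := 2) (fun n => by positivity) fun N => ?_
  rw [sum_range_catalan_div]
  have : 0 ≤ 2 * (N.centralBinom : ℝ) / 4 ^ N := by positivity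
  linarith

theorem tsum_catalan_div_le : ∑' k : ℕ, (catalan k : ℝ) / 4 ^ k ≤ 2 := by
  refine summable_catalan_div.tsum_le_of_sum_range_le fun N => ?_
  rw [sum_range_catalan_div]
  have : 0 ≤ 2 * (N.centralBinom : ℝ) / 4 ^ N := by positivity
  linarith

section
variable {H : Type*} [NormedAddCommGroup H] [InnerProductSpace ℝ H] [CompleteSpace H]

/-- `W = ∑ₖ Cₖ (E / 4) ^ k` with the Catalan numbers `Cₖ`, which satisfies `W = 1 + E W² / 4` by the
Catalan recursion. -/
theorem exists_catalan_series (E : H →L[ℝ] H) (hE : ‖E‖ ≤ 1) (hsa : IsSelfAdjoint E) :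
    ∃ W : H →L[ℝ] H, ‖W‖ ≤ 2 ∧ IsSelfAdjoint W ∧ Commute E W ∧ (4 : ℝ) • W = (4 : ℝ) • 1 + E * (W * W) := by
  have hpow : ∀ k : ℕ, ‖E ^ k‖ ≤ 1 := by
    intro k
    induction k with
    | zero => exact ContinuousLinearMap.norm_id_le
    | succ k ih =>
      rw [pow_succ]
      exact (norm_mul_le _ _).trans (mul_le_one₀ ih (norm_nonneg _) hE)
  set t : ℕ → (H →L[ℝ] H) := fun k => ((catalan k : ℝ) / 4 ^ k) • E ^ k with ht
  have hle : ∀ k, ‖t k‖ ≤ (catalan k : ℝ) / 4 ^ k := fun k => by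
    rw [ht, norm_smul, Real.norm_of_nonneg (by positivity)]
    exact mul_le_of_le_one_right (by positivity) (hpow k)
  have hn : Summable fun k => ‖t k‖ :=
    Summable.of_nonneg_of_le (fun _ => norm_nonneg _) hle summable_catalan_div
  have hs : Summable t := hn.of_norm
  refine ⟨∑' k, t k, ?_, ?_, ?_, ?_⟩
  · exact (norm_tsum_le_tsum_norm hn).trans
      ((hn.tsum_le_tsum hle summable_catalan_div).trans tsum_catalan_div_le)
  · rw [isSelfAdjoint_iff, tsum_star]
    refine tsum_congr fun k => ?_
    rw [ht, star_smul, (hsa.pow k).star_eq, star_trivial]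
  · rw [Commute, SemiconjBy, ← hs.tsum_mul_left, ← hs.tsum_mul_right]
    refine tsum_congr fun k => ?_
    rw [ht, mul_smul_comm, smul_mul_assoc, ← pow_succ, ← pow_succ']
  · rw [tsum_mul_tsum_eq_tsum_sum_antidiagonal_of_summable_norm hn hn, hs.tsum_eq_zero_add,
      ← Summable.tsum_mul_left]
    · have h0 : t 0 = 1 := by simp [ht]
      rw [h0, smul_add]
      congr 1
      rw [← ((summable_nat_add_iff 1).2 hs).tsum_const_smul]
      refine tsum_congr fun k => ?_
      have : ∀ p ∈ Finset.HasAntidiagonal.antidiagonal k, t p.1 * t p.2 =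
          ((catalan p.1 * catalan p.2 : ℕ) : ℝ) • ((1 / 4 ^ k : ℝ) • E ^ k) := by
        intro p hp
        rw [Finset.HasAntidiagonal.mem_antidiagonal] at hp
        rw [ht, smul_mul_smul_comm, ← pow_add, hp, smul_smul, ← hp]
        congr 1
        push_cast
        field_simp
        ring
      rw [Finset.sum_congr rfl this, ← Finset.sum_smul, ← Nat.cast_sum, ← catalan_succ', ht]
      simp only [mul_smul_comm, ← pow_succ', smul_smul]
      congr 1
      field_simp
      ring
    · exact (summable_norm_sum_mul_antidiagonal_of_summable_norm hn hn).of_norm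

/-- Every bounded positive operator on a real Hilbert space has a positive square root. After
rescaling to `0 ≤ T ≤ 1` one substitutes `E = 1 - T` into the power series of
`√(1 - x) = 1 - x / 2 * ∑ₖ Cₖ (x / 4) ^ k`, with the Catalan numbers `Cₖ`, which converges
absolutely on the closed unit ball. -/
theorem exists_isPositive_sqrt (T : H →L[ℝ] H) (hT : T.IsPositive) :
    ∃ S : H →L[ℝ] H, S.IsPositive ∧ S ∘L S = T := by
  have key : ∀ T : H →L[ℝ] H, T.IsPositive → ‖T‖ ≤ 1 →
      ∃ S : H →L[ℝ] H, S.IsPositive ∧ S * S = T := by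
    intro T hT h1
    have hEsa : IsSelfAdjoint (1 - T) := (IsSelfAdjoint.one _).sub hT.isSelfAdjoint
    have hTle : ∀ x, inner ℝ (T x) x ≤ ‖x‖ ^ 2 := fun x => by
      calc inner ℝ (T x) x ≤ ‖T x‖ * ‖x‖ := real_inner_le_norm _ _
        _ ≤ (1 * ‖x‖) * ‖x‖ := by
          gcongr; exact T.le_of_opNorm_le h1 x
        _ = ‖x‖ ^ 2 := by ring
    have hE : ‖1 - T‖ ≤ 1 := by
      rw [norm_eq_iSup_rayleighQuotient _ hEsa.isSymmetric]
      refine ciSup_le fun x => ?_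
      have h0 := hT.inner_nonneg_left x
      have h1 := hTle x
      rw [rayleighQuotient, abs_div, abs_of_nonneg (sq_nonneg ‖x‖)]
      refine div_le_one_of_le₀ ?_ (sq_nonneg _)
      simp only [reApplyInnerSelf_apply, RCLike.re_to_real, _root_.sub_apply, one_apply_eq_self,
        inner_sub_left, real_inner_self_eq_norm_sq]
      rw [abs_le]
      constructor <;> linarith
    obtain ⟨W, hW2, hWsa, hWc, hW⟩ := exists_catalan_series _ hE hEsa
    set E := 1 - T with hEdef
    refine ⟨1 - (1 / 2 : ℝ) • (E * W), ?_, ?_⟩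
    · rw [ContinuousLinearMap.isPositive_iff']
      have hEW : IsSelfAdjoint (E * W) := (hEsa.commute_iff hWsa).1 hWc
      have hN : ‖(1 / 2 : ℝ) • (E * W)‖ ≤ 1 := by
        rw [norm_smul, Real.norm_of_nonneg (by norm_num)]
        have := (norm_mul_le E W).trans (mul_le_mul hE hW2 (norm_nonneg _) zero_le_one)
        linarith
      refine ⟨(IsSelfAdjoint.one _).sub ((IsSelfAdjoint.all _).smul hEW), fun x => ?_⟩
      have h2 : inner ℝ (((1 / 2 : ℝ) • (E * W)) x) x ≤ ‖x‖ ^ 2 := by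
        calc _ ≤ ‖((1 / 2 : ℝ) • (E * W)) x‖ * ‖x‖ := real_inner_le_norm _ _
          _ ≤ (1 * ‖x‖) * ‖x‖ := by
            gcongr; exact ContinuousLinearMap.le_of_opNorm_le _ hN x
          _ = ‖x‖ ^ 2 := by ring
      rw [_root_.sub_apply, inner_sub_left, one_apply_eq_self,
        real_inner_self_eq_norm_sq]
      linarith
    · have e1 : (E * W) * (E * W) = (4 : ℝ) • (E * W) - (4 : ℝ) • E := by
        calc (E * W) * (E * W) = E * (E * (W * W)) := by
              rw [mul_assoc, ← mul_assoc W E W, ← hWc.eq]; noncomm_ring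
          _ = E * ((4 : ℝ) • W - (4 : ℝ) • 1) := by rw [hW, add_sub_cancel_left]
          _ = _ := by rw [mul_sub, mul_smul_comm, mul_smul_comm, mul_one]
      have : T = 1 - E := by rw [hEdef]; abel
      rw [this, sub_mul, one_mul, mul_sub, mul_one, smul_mul_smul_comm, e1]
      module
  -- rescale `T` to norm at most `1`
  obtain ⟨c, hc0, hc⟩ : ∃ c : ℝ, 0 < c ∧ ‖T‖ ≤ c := ⟨‖T‖ + 1, by positivity, by linarith⟩
  obtain ⟨S, hS, hSS⟩ := key (c⁻¹ • T) (hT.smul_of_nonneg (by positivity)) (by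
    rw [norm_smul, Real.norm_of_nonneg (by positivity)]
    rw [inv_mul_le_iff₀ hc0]; simpa using hc)
  refine ⟨√c • S, hS.smul_of_nonneg (Real.sqrt_nonneg c), ?_⟩
  change (√c • S) * (√c • S) = T
  rw [smul_mul_smul_comm, hSS, Real.mul_self_sqrt hc0.le, smul_smul, mul_inv_cancel₀ hc0.ne',
    one_smul]

theorem opSqrt_spec {T : H →L[ℝ] H} (hT : T.IsPositive) :
    (opSqrt T).IsPositive ∧ opSqrt T * opSqrt T = T := by
  have h := exists_isPositive_sqrt T hT
  rw [opSqrt, dif_pos h]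
  exact h.choose_spec

theorem denseRange_of_isSelfAdjoint {T : H →L[ℝ] H} (hT : IsSelfAdjoint T)
    (hinj : Function.Injective T) : DenseRange T := by
  have h : (LinearMap.range (T : H →ₗ[ℝ] H))ᗮ = ⊥ := by
    rw [ContinuousLinearMap.orthogonal_range, hT.adjoint_eq]
    exact LinearMap.ker_eq_bot.2 hinj
  exact Submodule.dense_iff_topologicalClosure_eq_top.2
    ((Submodule.topologicalClosure_eq_top_iff).2 h)

theorem injective_of_isUnit {V : H →L[ℝ] H} (hV : IsUnit V) : Function.Injective V :=
  (ContinuousLinearMap.isUnit_iff_bijective.1 hV).1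

omit [CompleteSpace H] in
theorem mul_right_cancel_of_denseRange {A B T : H →L[ℝ] H} (hT : DenseRange T)
    (h : A * T = B * T) : A = B := by
  have : (A : H → H) = B := hT.equalizer A.continuous B.continuous
    (funext fun x => congrArg (fun F : H →L[ℝ] H => F x) h)
  exact DFunLike.coe_injective this

omit [CompleteSpace H] in
theorem mul_left_cancel_of_injective {A B T : H →L[ℝ] H} (hT : Function.Injective T)
    (h : T * A = T * B) : A = B := by
  ext x
  exact hT (congrArg (fun F : H →L[ℝ] H => F x) h)

/-- A form of the polar decomposition: if `E² = S V V* S` with `E`, `S` self-adjoint, `S` injective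
and `V` invertible, then `E` and `S V` differ by a unitary factor on the right. -/
theorem exists_isUnit_factor {S E V : H →L[ℝ] H} (hS : IsSelfAdjoint S)
    (hSinj : Function.Injective S) (hE : IsSelfAdjoint E) (hV : IsUnit V)
    (h : E * E = S * (V * star V) * S) :
    ∃ Z : H →L[ℝ] H, IsUnit Z ∧ E = S * Z ∧ Z * star Z = V * star V := by
  have hVs : IsUnit (star V) := hV.star
  set F : H →L[ℝ] H := star V * S with hF
  have hFs : star F = S * V := by rw [hF, star_mul, star_star, hS.star_eq]
  have hFF : E * E = star F * F := by rw [h, hFs, hF]; noncomm_ring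
  have hFd : DenseRange F :=
    ((ContinuousLinearMap.isUnit_iff_bijective.1 hVs).2.denseRange).comp
      (denseRange_of_isSelfAdjoint hS hSinj) (star V).continuous
  have hFsinj : Function.Injective ⇑(star F) := by
    rw [hFs]; exact hSinj.comp (injective_of_isUnit hV)
  have hFinj : Function.Injective F := (injective_of_isUnit hVs).comp hSinj
  have hEinj : Function.Injective E := by
    have : Function.Injective (E * E) := by rw [hFF]; exact hFsinj.comp hFinj
    exact Function.Injective.of_comp this
  have hEd := denseRange_of_isSelfAdjoint hE hEinj
  have hnorm : ∀ x, ‖E x‖ = ‖F x‖ := by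
    intro x
    have h1 : inner ℝ ((E * E) x) x = inner ℝ ((star F * F) x) x := by rw [hFF]
    rw [← sq_eq_sq₀ (norm_nonneg _) (norm_nonneg _), ← real_inner_self_eq_norm_sq,
      ← real_inner_self_eq_norm_sq]
    exact (hE.isSymmetric (E x) x).symm.trans (h1.trans (adjoint_inner_left F x (F x)))
  have hQ : LinearMap.extendOfNorm (E : H →ₗ[ℝ] H) (F : H →ₗ[ℝ] H) * F = E := by
    ext x
    exact LinearMap.extendOfNorm_eq (f := (E : H →ₗ[ℝ] H)) (e := (F : H →ₗ[ℝ] H)) hFd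
      ⟨1, fun x => by simpa using (hnorm x).le⟩ x
  have hQ' : LinearMap.extendOfNorm (F : H →ₗ[ℝ] H) (E : H →ₗ[ℝ] H) * E = F := by
    ext x
    exact LinearMap.extendOfNorm_eq (f := (F : H →ₗ[ℝ] H)) (e := (E : H →ₗ[ℝ] H)) hEd
      ⟨1, fun x => by simpa using (hnorm x).ge⟩ x
  set Q := LinearMap.extendOfNorm (E : H →ₗ[ℝ] H) (F : H →ₗ[ℝ] H)
  set Q' := LinearMap.extendOfNorm (F : H →ₗ[ℝ] H) (E : H →ₗ[ℝ] H)
  have h1 : Q * Q' = 1 := mul_right_cancel_of_denseRange hEd (by rw [mul_assoc, hQ', hQ, one_mul])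
  have h2 : Q' * Q = 1 := mul_right_cancel_of_denseRange hFd (by rw [mul_assoc, hQ, hQ', one_mul])
  -- `Q` is unitary, so that `E = star F * star Q = S * (V * star Q)` is the required factorization
  have h3 : star Q * Q = 1 := by
    refine mul_right_cancel_of_denseRange hFd (mul_left_cancel_of_injective hFsinj ?_)
    calc star F * (star Q * Q * F) = star (Q * F) * (Q * F) := by
          rw [star_mul Q F]; simp only [mul_assoc]
      _ = star F * (1 * F) := by rw [hQ, hE.star_eq, hFF, one_mul]
  have hQu : IsUnit Q := ⟨⟨Q, Q', h1, h2⟩, rfl⟩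
  refine ⟨V * star Q, hV.mul hQu.star, ?_, ?_⟩
  · rw [← mul_assoc, ← hFs, ← star_mul, hQ, hE.star_eq]
  · rw [star_mul, star_star, mul_assoc, ← mul_assoc (star Q), h3, one_mul]

end

/-! ### Precisions, covariances and their inverses -/

section
variable {H : Type*} [NormedAddCommGroup H] [InnerProductSpace ℝ H]

theorem mem_graph_toUnbdd {T : H →L[ℝ] H} {x y : H} : (x, y) ∈ (toUnbdd T).graph ↔ T x = y := by
  rw [LinearPMap.mem_graph_iff]
  constructor
  · rintro ⟨z, hz, hy⟩
    simp only at hz hy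
    rw [← hz, ← hy]; rfl
  · intro h
    exact ⟨⟨x, Submodule.mem_top⟩, rfl, h⟩

theorem ker_toUnbdd {T : H →L[ℝ] H} (hT : Function.Injective T) :
    LinearMap.ker (toUnbdd T).toFun = ⊥ := by
  refine LinearMap.ker_eq_bot'.2 fun x hx => ?_
  have : T x = 0 := hx
  exact Subtype.ext (hT (by simpa using this))

theorem mem_graph_inverse {P : H →ₗ.[ℝ] H} (hP : LinearMap.ker P.toFun = ⊥) {x y : H} :
    (x, y) ∈ P.inverse.graph ↔ (y, x) ∈ P.graph := by
  rw [LinearPMap.inverse_graph hP, Submodule.mem_map]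
  constructor
  · rintro ⟨⟨a, b⟩, h, h'⟩
    obtain ⟨rfl, rfl⟩ := Prod.mk.inj h'
    exact h
  · intro h
    exact ⟨(y, x), h, rfl⟩

theorem mem_graph_add_toUnbdd {P : H →ₗ.[ℝ] H} {W : H →L[ℝ] H} {x y : H} :
    (x, y) ∈ (P + toUnbdd W).graph ↔ ∃ z, (x, z) ∈ P.graph ∧ y = z + W x := by
  simp only [LinearPMap.mem_graph_iff]
  constructor
  · rintro ⟨a, ha, hy⟩
    change (a : H) = x at ha
    change (P + toUnbdd W) a = y at hy
    refine ⟨P ⟨a, a.2.1⟩, ⟨⟨a, a.2.1⟩, ha, rfl⟩, ?_⟩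
    rw [← hy, LinearPMap.add_apply, ← ha]
    rfl
  · rintro ⟨z, ⟨a, ha, hz⟩, hy⟩
    change (a : H) = x at ha
    change P a = z at hz
    refine ⟨⟨x, ⟨ha ▸ a.2, Submodule.mem_top⟩⟩, rfl, ?_⟩
    rw [LinearPMap.add_apply]
    subst ha
    simp only [hy, ← hz]
    rfl

theorem toUnbdd_injective : Function.Injective (toUnbdd : (H →L[ℝ] H) → H →ₗ.[ℝ] H) := by
  intro A B h
  ext x
  have : (x, A x) ∈ (toUnbdd B).graph := h ▸ mem_graph_toUnbdd.2 rfl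
  exact (mem_graph_toUnbdd.1 this).symm

theorem boundedInverse_eq {P : H →ₗ.[ℝ] H} {C : H →L[ℝ] H} (h : P.inverse = toUnbdd C) :
    boundedInverse P = C := by
  have h' : ∃ T : H →L[ℝ] H, P.inverse = toUnbdd T := ⟨C, h⟩
  rw [boundedInverse, dif_pos h']
  exact toUnbdd_injective (h'.choose_spec.symm.trans h)

/-- The operator `(S²)⁻¹ + W` has the inverse `S (1 + S W S)⁻¹ S`. -/
theorem precision_inverse {S W X : H →L[ℝ] H} (hS : Function.Injective S)
    (h1 : (1 + S * W * S) * X = 1) (h2 : X * (1 + S * W * S) = 1) :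
    Function.Injective (S * X * S) ∧
    LinearMap.ker ((toUnbdd (S * S)).inverse + toUnbdd W).toFun = ⊥ ∧
    ((toUnbdd (S * S)).inverse + toUnbdd W).inverse = toUnbdd (S * X * S) ∧
    (toUnbdd (S * X * S)).inverse = (toUnbdd (S * S)).inverse + toUnbdd W := by
  have hD : ∀ x, X x + S (W (S (X x))) = x := fun x =>
    congrArg (fun F : H →L[ℝ] H => F x) h1
  have hX : ∀ x, X (x + S (W (S x))) = x := fun x =>
    congrArg (fun F : H →L[ℝ] H => F x) h2
  have hSS : Function.Injective (S * S) := hS.comp hS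
  have hXinj : Function.Injective X := fun x y h => by rw [← hD x, ← hD y, h]
  have hC : Function.Injective (S * X * S) := (hS.comp hXinj).comp hS
  set P := (toUnbdd (S * S)).inverse + toUnbdd W with hP
  -- `(x, y)` lies in the graph of `S⁻² + W` iff `x = S (S z)` and `y = z + W x` for some `z`
  have hgraph : ∀ x y, (x, y) ∈ P.graph ↔ (S * X * S) y = x := by
    intro x y
    rw [hP, mem_graph_add_toUnbdd]
    simp only [mem_graph_inverse (ker_toUnbdd hSS), mem_graph_toUnbdd]
    constructor
    · rintro ⟨z, rfl, rfl⟩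
      change S (X (S (z + W (S (S z))))) = S (S z)
      rw [map_add, hX]
    · rintro rfl
      refine ⟨y - W (S (X (S y))), ?_, ?_⟩
      · change S (S _) = S (X (S y))
        rw [map_sub, sub_eq_of_eq_add (hD (S y)).symm]
      · change y = y - W (S (X (S y))) + W (S (X (S y)))
        abel
  have hker : LinearMap.ker P.toFun = ⊥ := by
    refine LinearMap.ker_eq_bot'.2 fun x hx => ?_
    have : ((x : H), (0 : H)) ∈ P.graph := (LinearPMap.mem_graph_iff _).2 ⟨x, rfl, hx⟩
    rw [hgraph, map_zero] at this
    exact Subtype.ext this.symm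
  refine ⟨hC, hker, ?_, ?_⟩
  · refine LinearPMap.eq_of_eq_graph (Submodule.ext fun ⟨x, y⟩ => ?_)
    rw [mem_graph_inverse hker, hgraph, mem_graph_toUnbdd]
  · refine LinearPMap.eq_of_eq_graph (Submodule.ext fun ⟨x, y⟩ => ?_)
    rw [mem_graph_inverse (ker_toUnbdd hC), hgraph, mem_graph_toUnbdd]

end

section
variable {H : Type*} [NormedAddCommGroup H] [InnerProductSpace ℝ H] [CompleteSpace H]
variable {E : Type*} [NormedAddCommGroup E] [InnerProductSpace ℝ E] [CompleteSpace E]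

theorem isUnit_one_add {A : H →L[ℝ] H} (hA : A.IsPositive) : IsUnit (1 + A) := by
  refine isUnit_of_forall_le_norm_inner_map _ (c := 1) one_pos fun x => ?_
  rw [add_apply, inner_add_left, one_apply_eq_self, real_inner_self_eq_norm_sq]
  have := hA.inner_nonneg_left x
  rw [Real.norm_of_nonneg (by positivity)]
  simp [this]

theorem isPositive_of_inverse {D X : H →L[ℝ] H} (hD : D.IsPositive) (h : D * X = 1) :
    X.IsPositive := by
  have h1 : star X * D = 1 := by
    rw [← hD.isSelfAdjoint.star_eq, ← star_mul, h, star_one]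
  have h2 : X = star X * (D * X) := by rw [← mul_assoc, h1, one_mul]
  rw [h2]
  exact hD.adjoint_conj X

theorem isPositive_conj_self {S W : H →L[ℝ] H} (hS : IsSelfAdjoint S) (hW : W.IsPositive) :
    (S * W * S).IsPositive := by
  have := hW.conj_adjoint S
  rw [hS.adjoint_eq] at this
  exact this

theorem ring_inverse_eq {R : Type*} [MonoidWithZero R] {D X : R} (hD : IsUnit D) (h : D * X = 1) :
    Ring.inverse D = X := by
  rw [← mul_one (Ring.inverse D), ← h, ← mul_assoc, Ring.inverse_mul_cancel _ hD, one_mul]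

omit [CompleteSpace H] [CompleteSpace E] in
/-- Push-through form of the Sherman--Morrison--Woodbury identity. -/
theorem woodbury_mul {L : E →L[ℝ] H} {P : H →L[ℝ] E} {J : E →L[ℝ] E}
    (h : (1 + P ∘L L) * J = 1) : (1 + L ∘L P) * (1 - L ∘L J ∘L P) = 1 := by
  have h' : ∀ e, J e + P (L (J e)) = e := fun e => congrArg (fun F : E →L[ℝ] E => F e) h
  ext x
  change (x - L (J (P x))) + L (P (x - L (J (P x)))) = x
  have := congrArg L (h' (P x))
  rw [map_add] at this
  rw [map_sub, map_sub, ← this]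
  abel

/-- The covariance `S (1 + S U U* S)⁻¹ S`, the inverse of the precision `S⁻² + U U*`. -/
def lowRankCov (S : H →L[ℝ] H) (U : E →L[ℝ] H) : H →L[ℝ] H :=
  S * Ring.inverse (1 + S * (U ∘L adjoint U) * S) * S

theorem isUnit_lowRank {S : H →L[ℝ] H} (hS : IsSelfAdjoint S) (U : E →L[ℝ] H) :
    IsUnit (1 + S * (U ∘L adjoint U) * S) :=
  isUnit_one_add (isPositive_conj_self hS (isPositive_self_comp_adjoint U))

theorem lowRankCov_eq_of_mul_eq_one {S X : H →L[ℝ] H} (hS : IsSelfAdjoint S) {U : E →L[ℝ] H}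
    (h : (1 + S * (U ∘L adjoint U) * S) * X = 1) : lowRankCov S U = S * X * S := by
  rw [lowRankCov, ring_inverse_eq (isUnit_lowRank hS U) h]

theorem adjoint_comp_selfAdjoint {S : H →L[ℝ] H} (hS : IsSelfAdjoint S) (U : E →L[ℝ] H) :
    adjoint (S ∘L U) = adjoint U ∘L S := by
  rw [adjoint_comp, hS.adjoint_eq]

theorem isStrictlyPos_conj {S D X : H →L[ℝ] H} (hS : IsSelfAdjoint S)
    (hSinj : Function.Injective S) (hD : D.IsPositive) (h : D * X = 1)
    (hD' : ∀ v, v ≠ 0 → 0 < inner ℝ (D v) v) : IsStrictlyPos (S * X * S) := by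
  have hX := isPositive_of_inverse hD h
  have hDX : ∀ x, D (X x) = x := fun x => congrArg (fun F : H →L[ℝ] H => F x) h
  refine ⟨(isPositive_conj_self hS hX).isSelfAdjoint, fun y hy => ?_⟩
  have h1 : inner ℝ ((S * X * S) y) y = inner ℝ (D (X (S y))) (X (S y)) := by
    rw [hDX, real_inner_comm (X (S y))]
    exact hS.isSymmetric _ _
  rw [h1]
  refine hD' _ fun h0 => hy (hSinj ?_)
  rw [map_zero, ← hDX (S y), h0, map_zero]

omit [CompleteSpace H] in
theorem inner_one_add_pos {A : H →L[ℝ] H} (hA : A.IsPositive) {v : H} (hv : v ≠ 0) :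
    0 < inner ℝ ((1 + A) v) v := by
  rw [add_apply, inner_add_left, one_apply_eq_self, real_inner_self_eq_norm_sq]
  have := hA.inner_nonneg_left v
  have : 0 < ‖v‖ := norm_pos_iff.2 hv
  positivity

theorem lowRankCov_mem_covClass {S Cpr : H →L[ℝ] H} (hS : IsSelfAdjoint S)
    (hSinj : Function.Injective S) (hSS : S * S = Cpr) {r : ℕ}
    (U : EuclideanSpace ℝ (Fin r) →L[ℝ] H) : lowRankCov S U ∈ covClass Cpr r := by
  have hpos := isPositive_adjoint_comp_self (S ∘L U)
  obtain ⟨J, hJ⟩ := (isUnit_one_add hpos).exists_right_inv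
  obtain ⟨R, hR, hRR⟩ := exists_isPositive_sqrt J (isPositive_of_inverse (isPositive_one.add hpos) hJ)
  have hD := isPositive_conj_self hS (isPositive_self_comp_adjoint U)
  have hX : (1 + S * (U ∘L adjoint U) * S) *
      (1 - (S ∘L U) ∘L J ∘L adjoint (S ∘L U)) = 1 := by
    have h := woodbury_mul hJ
    rw [adjoint_comp_selfAdjoint hS] at h ⊢
    exact h
  have hCpr : adjoint Cpr = Cpr := by
    rw [← hSS]
    change star (S * S) = S * S
    rw [star_mul, hS.star_eq]
  rw [lowRankCov_eq_of_mul_eq_one hS hX]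
  -- with `L = S U` and `R² = (1 + L* L)⁻¹` the inverse of `1 + L L*` is `1 - (L R) (L R)*`
  refine ⟨Cpr ∘L U ∘L R, ?_, ?_, isStrictlyPos_conj hS hSinj (isPositive_one.add hD) hX
    fun v hv => inner_one_add_pos hD hv⟩
  · rintro _ ⟨x, rfl⟩
    exact ⟨U (R x), rfl⟩
  · rw [adjoint_comp Cpr, adjoint_comp U, hCpr, hR.isSelfAdjoint.adjoint_eq,
      adjoint_comp_selfAdjoint hS,
      ← hRR, ← hSS]
    ext x
    simp

omit [CompleteSpace E] in
theorem isUnit_of_injective [FiniteDimensional ℝ E] {T : E →L[ℝ] E} (hT : Function.Injective T) :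
    IsUnit T :=
  haveI := FiniteDimensional.complete ℝ E
  isUnit_iff_bijective.2
    ⟨hT, (LinearMap.injective_iff_surjective (f := (T : E →ₗ[ℝ] E))).1 hT⟩

omit [CompleteSpace H] [CompleteSpace E] in
theorem exists_comp_eq_of_range_subset [FiniteDimensional ℝ E] {T : H →L[ℝ] H}
    (hT : Function.Injective T) {K : E →L[ℝ] H} (hK : Set.range K ⊆ Set.range T) :
    ∃ K₀ : E →L[ℝ] H, T ∘L K₀ = K := by
  let K₀ : E →ₗ[ℝ] H := (LinearEquiv.ofInjective (T : H →ₗ[ℝ] H) hT).symm.toLinearMap ∘ₗ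
    (K : E →ₗ[ℝ] H).codRestrict (LinearMap.range (T : H →ₗ[ℝ] H)) fun x => hK ⟨x, rfl⟩
  refine ⟨LinearMap.toContinuousLinearMap K₀, ?_⟩
  ext x
  exact congrArg Subtype.val ((LinearEquiv.ofInjective (T : H →ₗ[ℝ] H) hT).apply_symm_apply
    ⟨K x, hK ⟨x, rfl⟩⟩)

theorem exists_lowRankCov_of_mem_covClass {S Cpr : H →L[ℝ] H} (hS : IsSelfAdjoint S)
    (hSinj : Function.Injective S) (hSS : S * S = Cpr) {r : ℕ} {C : H →L[ℝ] H}
    (hC : C ∈ covClass Cpr r) :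
    ∃ U : EuclideanSpace ℝ (Fin r) →L[ℝ] H, C = lowRankCov S U := by
  obtain ⟨K, hK, rfl, -, hpos⟩ := hC
  obtain ⟨K₀, rfl⟩ := exists_comp_eq_of_range_subset (by rw [← hSS]; exact hSinj.comp hSinj) hK
  set L := S ∘L K₀ with hL
  have hKL : Cpr ∘L K₀ = S ∘L L := by rw [← hSS]; rfl
  rw [hKL] at hpos ⊢
  have hform : ∀ h, inner ℝ ((Cpr - (S ∘L L) ∘L adjoint (S ∘L L)) h) h =
      ‖S h‖ ^ 2 - ‖adjoint L (S h)‖ ^ 2 := by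
    intro h
    rw [_root_.sub_apply, inner_sub_left, ← hSS, ← real_inner_self_eq_norm_sq,
      ← real_inner_self_eq_norm_sq]
    congr 1
    · exact hS.isSymmetric _ _
    · rw [comp_apply, ← adjoint_inner_right, adjoint_comp_selfAdjoint hS]
      rfl
  -- positivity of `C` gives `‖L* v‖ ≤ ‖v‖` on the range of `S`, which is dense
  have hLs : ∀ v, ‖adjoint L v‖ ≤ ‖v‖ := fun v => by
    refine (denseRange_of_isSelfAdjoint hS hSinj).induction_on v
      (isClosed_le (by fun_prop) (by fun_prop)) fun h => ?_
    rcases eq_or_ne h 0 with rfl | hh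
    · simp
    · have := hpos h hh
      rw [hform] at this
      exact abs_le_of_sq_le_sq' (by linarith) (norm_nonneg _) |>.2
  have hLn : ∀ a, ‖L a‖ ≤ ‖a‖ := fun a => by
    have h1 : ‖adjoint L‖ ≤ 1 := opNorm_le_bound _ zero_le_one fun v => by simpa using hLs v
    rw [LinearIsometryEquiv.norm_map] at h1
    simpa using L.le_of_opNorm_le h1 a
  set A : EuclideanSpace ℝ (Fin r) →L[ℝ] EuclideanSpace ℝ (Fin r) := 1 - adjoint L ∘L L with hA
  have hApos : A.IsPositive := by
    rw [isPositive_iff']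
    refine ⟨(IsSelfAdjoint.one _).sub (isPositive_adjoint_comp_self L).isSelfAdjoint, fun a => ?_⟩
    rw [hA, _root_.sub_apply, inner_sub_left, one_apply_eq_self, real_inner_self_eq_norm_sq,
      comp_apply, adjoint_inner_left, real_inner_self_eq_norm_sq, sub_nonneg]
    exact pow_le_pow_left₀ (norm_nonneg _) (hLn a) 2
  -- the kernel of `1 - L* L` is mapped by `K₀` into the kernel of the form of `C`
  have hAinj : Function.Injective A := by
    refine (injective_iff_map_eq_zero A).2 fun a ha => ?_
    have h1 : a = adjoint L (L a) := sub_eq_zero.1 ha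
    by_contra hne
    have hK0 : K₀ a ≠ 0 := fun h0 => hne (by rw [h1, hL, comp_apply, h0, map_zero, map_zero])
    have h2 := hpos _ hK0
    rw [hform] at h2
    change 0 < ‖L a‖ ^ 2 - ‖adjoint L (L a)‖ ^ 2 at h2
    rw [← h1] at h2
    have := pow_le_pow_left₀ (norm_nonneg _) (hLn a) 2
    linarith
  have hAu : IsUnit A := isUnit_of_injective hAinj
  obtain ⟨J, hJ⟩ := hAu.exists_right_inv
  have hJ' : J * A = 1 := by
    obtain ⟨J', hJ'⟩ := hAu.exists_left_inv
    rwa [left_inv_eq_right_inv hJ' hJ] at hJ'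
  obtain ⟨R, hR, hRR⟩ := exists_isPositive_sqrt J (isPositive_of_inverse hApos hJ)
  -- `(1 - L L*)⁻¹ = 1 + L J L*` with `J = (1 - L* L)⁻¹ = R²`, and `L R = S (K₀ R)`
  refine ⟨K₀ ∘L R, ?_⟩
  have h1 : (1 + (J ∘L adjoint L) ∘L L) * A = 1 := by
    have : (J ∘L adjoint L) ∘L L = J * (1 - A) := by rw [hA, sub_sub_cancel]; rfl
    rw [this, mul_sub J, hJ', mul_one, add_sub_cancel, hJ']
  have h2 := woodbury_mul h1
  have h3 : 1 + S * ((K₀ ∘L R) ∘L adjoint (K₀ ∘L R)) * S = 1 + L ∘L J ∘L adjoint L := by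
    rw [adjoint_comp, hR.isSelfAdjoint.adjoint_eq, hL, adjoint_comp_selfAdjoint hS, ← hRR]
    rfl
  have h4 : A ∘L J ∘L adjoint L = adjoint L := by
    rw [← comp_assoc]
    change (A * J) ∘L _ = _
    rw [hJ]; rfl
  rw [h4] at h2
  rw [lowRankCov_eq_of_mul_eq_one hS (h3.symm ▸ h2), adjoint_comp_selfAdjoint hS, ← hSS]
  ext x
  simp

theorem IsStrictlyPos.isPositive {T : H →L[ℝ] H} (hT : IsStrictlyPos T) : T.IsPositive := by
  rw [isPositive_iff']
  refine ⟨hT.1, fun x => ?_⟩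
  rcases eq_or_ne x 0 with rfl | hx
  · simp
  · exact (hT.2 x hx).le

theorem IsStrictlyPos.injective {T : H →L[ℝ] H} (hT : IsStrictlyPos T) :
    Function.Injective T := by
  refine (injective_iff_map_eq_zero T).2 fun x hx => ?_
  by_contra hne
  have := hT.2 x hne
  rw [hx, inner_zero_left] at this
  exact this.false

theorem IsStrictlyPos.isUnit [FiniteDimensional ℝ E] {T : E →L[ℝ] E} (hT : IsStrictlyPos T) :
    IsUnit T :=
  isUnit_of_injective hT.injective

/-- The posterior covariance is `S (1 + S (G* C_obs⁻¹ G) S)⁻¹ S` with `S² = C_pr`. -/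
theorem posteriorCov_eq {n : ℕ} (G : H →L[ℝ] EuclideanSpace ℝ (Fin n))
    {Cobs : EuclideanSpace ℝ (Fin n) →L[ℝ] EuclideanSpace ℝ (Fin n)} (hCobs : IsStrictlyPos Cobs)
    {S Cpr Y : H →L[ℝ] H} (hS : IsSelfAdjoint S) (hSS : S * S = Cpr)
    (hY : Y * (1 + S ∘L hessian G Cobs ∘L S) = 1) : posteriorCov G Cobs Cpr = S * Y * S := by
  set V := G ∘L S with hV
  have hVs : adjoint V = S ∘L adjoint G := by rw [hV, adjoint_comp, hS.adjoint_eq]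
  have hVV : V ∘L adjoint V = G ∘L Cpr ∘L adjoint G := by rw [hVs, ← hSS]; rfl
  set M := Cobs + V ∘L adjoint V with hM
  have hMu : IsUnit M := by
    have hp := isPositive_self_comp_adjoint V
    refine IsStrictlyPos.isUnit ⟨hCobs.1.add hp.isSelfAdjoint, fun x hx => ?_⟩
    rw [hM, add_apply, inner_add_left]
    have := hp.inner_nonneg_left x
    have := hCobs.2 x hx
    positivity
  have hM1 : ∀ y, M (Ring.inverse M y) = y := fun y =>
    congrArg (fun F : _ →L[ℝ] _ => F y) (Ring.mul_inverse_cancel M hMu)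
  have hC1 : ∀ y, Ring.inverse Cobs (Cobs y) = y := fun y =>
    congrArg (fun F : _ →L[ℝ] _ => F y) (Ring.inverse_mul_cancel Cobs hCobs.isUnit)
  have hX : (1 + S ∘L hessian G Cobs ∘L S) * (1 - adjoint V ∘L Ring.inverse M ∘L V) = 1 := by
    have hT : S ∘L hessian G Cobs ∘L S = adjoint V ∘L Ring.inverse Cobs ∘L V := by
      rw [hVs]; rfl
    rw [hT]
    ext x
    set y := Ring.inverse M (V x) with hy
    have h1 : V x = Cobs y + V (adjoint V y) := (hM1 (V x)).symm
    change (x - adjoint V y) + adjoint V (Ring.inverse Cobs (V (x - adjoint V y))) = x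
    rw [map_sub, sub_eq_of_eq_add h1, hC1]
    abel
  have hYX : Y = 1 - adjoint V ∘L Ring.inverse M ∘L V := left_inv_eq_right_inv hY hX
  rw [hYX, posteriorCov, ← hVV, ← hM, hVs, ← hSS, hV]
  ext x
  simp

end

/-! ### Spectral losses up to similarity -/

section
variable {H : Type*} [NormedAddCommGroup H] [InnerProductSpace ℝ H] [CompleteSpace H]

omit [CompleteSpace H] in
theorem isUnit_of_mul_self {A B : H →L[ℝ] H} (h : B * B = A) (hA : IsUnit A) : IsUnit B := by
  rw [← h] at hA
  exact ((Commute.refl B).isUnit_mul_iff.1 hA).1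

omit [CompleteSpace H] in
theorem finrank_eigenspace_eq {A B G : H →L[ℝ] H} (hG : IsUnit G) (h : G * A = B * G) (μ : ℝ) :
    Module.finrank ℝ (Module.End.eigenspace (A : H →ₗ[ℝ] H) μ) =
      Module.finrank ℝ (Module.End.eigenspace (B : H →ₗ[ℝ] H) μ) := by
  obtain ⟨⟨G, G', h1, h2⟩, rfl⟩ := hG
  have hGG' : ∀ x, G (G' x) = x := fun x => congrArg (fun F : H →L[ℝ] H => F x) h1
  have hG'G : ∀ x, G' (G x) = x := fun x => congrArg (fun F : H →L[ℝ] H => F x) h2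
  have hGA : ∀ x, G (A x) = B (G x) := fun x => congrArg (fun F : H →L[ℝ] H => F x) h
  let e : H ≃ₗ[ℝ] H := LinearEquiv.ofLinearMap (G : H →ₗ[ℝ] H) (G' : H →ₗ[ℝ] H)
    (LinearMap.ext hGG') (LinearMap.ext hG'G)
  have hmap : (Module.End.eigenspace (A : H →ₗ[ℝ] H) μ).map (e : H →ₗ[ℝ] H) =
      Module.End.eigenspace (B : H →ₗ[ℝ] H) μ := by
    ext y
    simp only [Submodule.mem_map, Module.End.mem_eigenspace_iff]
    constructor
    · rintro ⟨x, hx, rfl⟩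
      change B (G x) = μ • G x
      rw [← hGA, ← map_smul]
      exact congrArg G hx
    · intro hy
      refine ⟨G' y, ?_, hGG' y⟩
      change A (G' y) = μ • G' y
      change B y = μ • y at hy
      rw [← hG'G (A (G' y)), hGA, hGG', hy, map_smul]
  rw [← hmap]
  exact (LinearEquiv.finrank_map_eq e _).symm

omit [CompleteSpace H] in
theorem invSqrtMulSqrt_eq {C₁ C₂ A : H →L[ℝ] H} (hinj : Function.Injective (opSqrt C₁))
    (h : opSqrt C₁ ∘L A = opSqrt C₂) : invSqrtMulSqrt C₁ C₂ = A := by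
  have h' : ∃ A : H →L[ℝ] H, opSqrt C₁ ∘L A = opSqrt C₂ := ⟨A, h⟩
  rw [invSqrtMulSqrt, dif_pos h']
  exact mul_left_cancel_of_injective hinj (h'.choose_spec.trans h.symm)

theorem injective_opSqrt {T : H →L[ℝ] H} (hT : T.IsPositive) (hinj : Function.Injective T) :
    Function.Injective (opSqrt T) := by
  have h := (opSqrt_spec hT).2
  have : Function.Injective (opSqrt T * opSqrt T) := by rw [h]; exact hinj
  exact Function.Injective.of_comp this

/-- For `C = S D⁻¹ S` and `C_pos = S V² S` the operator `A = C^{-1/2} C_pos^{1/2}` exists, is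
invertible, and `A A*` is similar to `V D V`. -/
theorem exists_sqrt_quotient {S D X V : H →L[ℝ] H} (hS : IsSelfAdjoint S)
    (hSinj : Function.Injective S) (hD : D.IsPositive) (h1 : D * X = 1) (h2 : X * D = 1)
    (hV : V.IsPositive) (hVu : IsUnit V) :
    ∃ A G : H →L[ℝ] H, opSqrt (S * X * S) ∘L A = opSqrt (S * (V * V) * S) ∧ IsUnit A ∧ IsUnit G ∧
      G * (A * star A) = V * D * V * G := by
  have hX : X.IsPositive := isPositive_of_inverse hD h1
  have hXu : IsUnit X := ⟨⟨X, D, h2, h1⟩, rfl⟩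
  obtain ⟨B, hB, hBB⟩ := exists_isPositive_sqrt X hX
  have hBu : IsUnit B := isUnit_of_mul_self hBB hXu
  have hVV : (V * V).IsPositive := by
    have := isPositive_conj_self hV.isSelfAdjoint (isPositive_one (𝕜 := ℝ) (E := H))
    rwa [mul_one] at this
  obtain ⟨hE, hEE⟩ := opSqrt_spec (isPositive_conj_self hS hX)
  obtain ⟨hE', hEE'⟩ := opSqrt_spec (isPositive_conj_self hS hVV)
  have hBs : B * star B = X := by rw [hB.isSelfAdjoint.star_eq]; exact hBB
  have hVs : V * star V = V * V := by rw [hV.isSelfAdjoint.star_eq]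
  obtain ⟨Z, ⟨⟨Z, Zi, hZ1, hZ2⟩, rfl⟩, hEZ, hZZ⟩ := exists_isUnit_factor hS hSinj hE.isSelfAdjoint hBu
    (by rw [hEE, hBs])
  obtain ⟨Z', hZ'u, hEZ', hZZ'⟩ := exists_isUnit_factor hS hSinj hE'.isSelfAdjoint hVu
    (by rw [hEE', hVs])
  simp only at hEZ hZZ
  rw [hBs] at hZZ
  rw [hVs] at hZZ'
  have hZiu : IsUnit Zi := ⟨⟨Zi, Z, hZ2, hZ1⟩, rfl⟩
  have hDZ : star Zi * Zi = D := by
    have h3 : X * (star Zi * Zi) = 1 := by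
      have h4 : star Z * star Zi = 1 := by rw [← star_mul, hZ2, star_one]
      calc X * (star Zi * Zi) = Z * (star Z * star Zi) * Zi := by rw [← hZZ]; simp only [mul_assoc]
        _ = 1 := by rw [h4, mul_one, hZ1]
    exact (left_inv_eq_right_inv h1 h3).symm
  -- `C^{1/2} = S Z` and `C_pos^{1/2} = S Z'`, where `Z Z* = D⁻¹` and `Z' Z'* = V²`
  refine ⟨Zi * Z', V * star Zi, ?_, hZiu.mul hZ'u, hVu.mul hZiu.star, ?_⟩
  · change _ * (Zi * Z') = _
    rw [hEZ, hEZ', mul_assoc, ← mul_assoc Z, hZ1, one_mul]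
  · calc V * star Zi * (Zi * Z' * star (Zi * Z'))
        = V * (star Zi * Zi) * (Z' * star Z') * star Zi := by
          rw [star_mul]; simp only [mul_assoc]
      _ = V * D * V * (V * star Zi) := by rw [hDZ, hZZ']; simp only [mul_assoc]

theorem isHilbertSchmidt_of_finiteDimensional_range {ι : Type} (b : HilbertBasis ι ℝ H)
    (T : H →L[ℝ] H) [FiniteDimensional ℝ (LinearMap.range (T : H →ₗ[ℝ] H))] :
    IsHilbertSchmidt T := by
  refine ⟨ι, b, ?_⟩
  let e := stdOrthonormalBasis ℝ (LinearMap.range (T : H →ₗ[ℝ] H))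
  have h : ∀ i, ‖T (b i)‖ ^ 2 = ∑ k, ‖inner ℝ (b i) (adjoint T (e k))‖ ^ 2 := fun i => by
    have := e.sum_sq_norm_inner_right ⟨T (b i), b i, rfl⟩
    change _ = ‖T (b i)‖ ^ 2 at this
    rw [← this]
    refine Finset.sum_congr rfl fun k _ => ?_
    rw [adjoint_inner_right, real_inner_comm]
    rfl
  simp_rw [h]
  exact summable_sum fun k _ => b.orthonormal.inner_products_summable _

omit [CompleteSpace H] in
theorem finiteDimensional_range_mul_right (A B : H →L[ℝ] H)
    [FiniteDimensional ℝ (LinearMap.range (A : H →ₗ[ℝ] H))] :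
    FiniteDimensional ℝ (LinearMap.range ((A * B : H →L[ℝ] H) : H →ₗ[ℝ] H)) :=
  Submodule.finiteDimensional_of_le (S₂ := LinearMap.range (A : H →ₗ[ℝ] H))
    (by rintro _ ⟨x, rfl⟩; exact ⟨B x, rfl⟩)

omit [CompleteSpace H] in
theorem finiteDimensional_range_mul_left (A B : H →L[ℝ] H)
    [FiniteDimensional ℝ (LinearMap.range (B : H →ₗ[ℝ] H))] :
    FiniteDimensional ℝ (LinearMap.range ((A * B : H →L[ℝ] H) : H →ₗ[ℝ] H)) :=
  Submodule.finiteDimensional_of_le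
    (S₂ := (LinearMap.range (B : H →ₗ[ℝ] H)).map (A : H →ₗ[ℝ] H))
    (by rintro _ ⟨x, rfl⟩; exact ⟨B x, ⟨x, rfl⟩, rfl⟩)

theorem hasFiniteTrace_conj {S X : H →L[ℝ] H} (hS : IsSelfAdjoint S)
    (htr : HasFiniteTrace (S * S)) (hX : X.IsPositive) : HasFiniteTrace (S * X * S) := by
  obtain ⟨ι, b, hb⟩ := htr
  refine ⟨ι, b, Summable.of_nonneg_of_le
    (fun i => (isPositive_conj_self hS hX).inner_nonneg_left _) (fun i => ?_) (hb.mul_left ‖X‖)⟩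
  have h1 : inner ℝ ((S * X * S) (b i)) (b i) = inner ℝ (X (S (b i))) (S (b i)) :=
    hS.isSymmetric _ _
  have h2 : inner ℝ ((S * S) (b i)) (b i) = inner ℝ (S (b i)) (S (b i)) := hS.isSymmetric _ _
  rw [h1, h2, real_inner_self_eq_norm_sq]
  calc _ ≤ ‖X (S (b i))‖ * ‖S (b i)‖ := real_inner_le_norm _ _
    _ ≤ (‖X‖ * ‖S (b i)‖) * ‖S (b i)‖ := by gcongr; exact X.le_opNorm _
    _ = _ := by ring

section Competitors

variable {E : Type*} [NormedAddCommGroup E] [InnerProductSpace ℝ E] [CompleteSpace E]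

/-- The self-adjoint operator `V (1 + S U U* S) V - 1`, which is similar to
`R(S V² S ‖ lowRankCov S U)`. -/
def relOp (S V : H →L[ℝ] H) (U : E →L[ℝ] H) : H →L[ℝ] H :=
  V * (1 + S * (U ∘L adjoint U) * S) * V - 1

theorem lowRankCov_properties {S V : H →L[ℝ] H} (hS : IsSelfAdjoint S)
    (hSinj : Function.Injective S) (htr : HasFiniteTrace (S * S)) (hV : V.IsPositive)
    (hVu : IsUnit V) (U : E →L[ℝ] H)
    (hfin : FiniteDimensional ℝ (LinearMap.range (relOp S V U : H →ₗ[ℝ] H))) :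
    lowRankCov S U ∈ equivalentCovs (S * (V * V) * S) ∧
    ∀ f μ, lossTerm f (S * (V * V) * S) (lowRankCov S U) μ =
      (Module.finrank ℝ (Module.End.eigenspace (relOp S V U : H →ₗ[ℝ] H) μ) : ℝ) * f μ := by
  have hDpos : (1 + S * (U ∘L adjoint U) * S).IsPositive :=
    isPositive_one.add (isPositive_conj_self hS (isPositive_self_comp_adjoint U))
  have hDu := isUnit_lowRank hS U
  have h1 := Ring.mul_inverse_cancel _ hDu
  have h2 := Ring.inverse_mul_cancel _ hDu
  obtain ⟨A, G, hA, hAu, hGu, hGA⟩ := exists_sqrt_quotient hS hSinj hDpos h1 h2 hV hVu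
  have hXpos := isPositive_of_inverse hDpos h1
  have hGR : G * (A * star A - 1) = relOp S V U * G := by
    rw [relOp, mul_sub, sub_mul, hGA, mul_one, one_mul]
  have hCpos : (lowRankCov S U).IsPositive := isPositive_conj_self hS hXpos
  have hCinj : Function.Injective (lowRankCov S U) :=
    (precision_inverse hSinj h1 h2).1
  have hinj := injective_opSqrt hCpos hCinj
  obtain ⟨ι, b, hb⟩ := id htr
  constructor
  · refine ⟨hCpos, hasFiniteTrace_conj hS htr hXpos, A, hA, hAu, ?_⟩
    obtain ⟨⟨G, Gi, hG1, hG2⟩, rfl⟩ := hGu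
    have : A ∘L adjoint A - 1 = Gi * (relOp S V U * G) := by
      rw [← hGR, ← mul_assoc]
      change _ = (Gi * G) * _
      rw [hG2, one_mul]; rfl
    rw [this]
    have := finiteDimensional_range_mul_right (relOp S V U) G
    have := finiteDimensional_range_mul_left Gi (relOp S V U * G)
    exact isHilbertSchmidt_of_finiteDimensional_range b _
  · intro f μ
    have hfh : fhOperator (S * (V * V) * S) (lowRankCov S U) = A * star A - 1 := by
      rw [fhOperator, invSqrtMulSqrt_eq hinj hA]; rfl
    rw [lossTerm, hfh, finrank_eigenspace_eq hGu hGR]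

end Competitors

theorem mem_equivalentCovs_self {S X : H →L[ℝ] H} (hS : IsSelfAdjoint S)
    (htr : HasFiniteTrace (S * S)) (hX : X.IsPositive) :
    S * X * S ∈ equivalentCovs (S * X * S) := by
  obtain ⟨ι, b, hb⟩ := id htr
  refine ⟨isPositive_conj_self hS hX, hasFiniteTrace_conj hS htr hX, 1, mul_one _, isUnit_one, ι, b,
    ?_⟩
  have : (1 : H →L[ℝ] H) ∘L adjoint (1 : H →L[ℝ] H) - 1 = 0 := by
    change (1 : H →L[ℝ] H) * star 1 - 1 = 0
    rw [star_one, one_mul, sub_self]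
  simp [this]

end

/-! ### Diagonal operators and eigenbases -/

section
variable {H : Type*} [NormedAddCommGroup H] [InnerProductSpace ℝ H]

/-- The finite-rank operator `∑_{i < m} aᵢ wᵢ ⊗ wᵢ`. -/
def diagOp (w : ℕ → H) (m : ℕ) (a : ℕ → ℝ) : H →L[ℝ] H :=
  ∑ i ∈ Finset.range m, a i • InnerProductSpace.rankOne ℝ (w i) (w i)

theorem diagOp_apply (w : ℕ → H) (m : ℕ) (a : ℕ → ℝ) (x : H) :
    diagOp w m a x = ∑ i ∈ Finset.range m, (a i * inner ℝ (w i) x) • w i := by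
  simp [diagOp, mul_smul]

theorem inner_diagOp (w : ℕ → H) (m : ℕ) (a : ℕ → ℝ) (x y : H) :
    inner ℝ (diagOp w m a x) y =
      ∑ i ∈ Finset.range m, a i * (inner ℝ (w i) x * inner ℝ (w i) y) := by
  simp [diagOp_apply, sum_inner, real_inner_smul_left, mul_assoc]

theorem diagOp_congr {w : ℕ → H} {m : ℕ} {a b : ℕ → ℝ} (h : ∀ i < m, a i = b i) :
    diagOp w m a = diagOp w m b :=
  Finset.sum_congr rfl fun i hi => by rw [h i (Finset.mem_range.1 hi)]

theorem diagOp_add (w : ℕ → H) (m : ℕ) (a b : ℕ → ℝ) :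
    diagOp w m (a + b) = diagOp w m a + diagOp w m b := by
  simp [diagOp, add_smul, Finset.sum_add_distrib]

theorem diagOp_apply_self {w : ℕ → H} {m : ℕ} (hw : Orthonormal ℝ fun i : Fin m => w i)
    (a : ℕ → ℝ) {j : ℕ} (hj : j < m) : diagOp w m a (w j) = a j • w j := by
  rw [diagOp_apply, Finset.sum_eq_single j]
  · have := hw.1 ⟨j, hj⟩
    simp only at this
    rw [real_inner_self_eq_norm_sq, this]; simp
  · intro i hi hij
    have : inner ℝ (w i) (w j) = 0 :=
      hw.2 (i := ⟨i, Finset.mem_range.1 hi⟩) (j := ⟨j, hj⟩) (by simpa using hij)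
    rw [this]; simp
  · intro h
    exact absurd (Finset.mem_range.2 hj) h

theorem diagOp_mul {w : ℕ → H} {m : ℕ} (hw : Orthonormal ℝ fun i : Fin m => w i) (a b : ℕ → ℝ) :
    diagOp w m a * diagOp w m b = diagOp w m (a * b) := by
  ext x
  change diagOp w m a (diagOp w m b x) = _
  rw [diagOp_apply w m b, map_sum, diagOp_apply]
  refine Finset.sum_congr rfl fun i hi => ?_
  rw [map_smul, diagOp_apply_self hw a (Finset.mem_range.1 hi), smul_smul, Pi.mul_apply]
  congr 1
  ring

theorem one_add_diagOp_mul {w : ℕ → H} {m : ℕ} (hw : Orthonormal ℝ fun i : Fin m => w i)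
    (a b : ℕ → ℝ) :
    (1 + diagOp w m a) * (1 + diagOp w m b) = 1 + diagOp w m (a + b + a * b) := by
  rw [diagOp_add, diagOp_add, ← diagOp_mul hw]
  noncomm_ring

theorem one_add_diagOp_eq_one {w : ℕ → H} {m : ℕ} {a : ℕ → ℝ} (h : ∀ i < m, a i = 0) :
    1 + diagOp w m a = 1 := by
  rw [diagOp_congr (b := 0) h]
  simp [diagOp]

theorem isUnit_one_add_diagOp {w : ℕ → H} {m : ℕ} (hw : Orthonormal ℝ fun i : Fin m => w i)
    {a : ℕ → ℝ} (ha : ∀ i < m, -1 < a i) : IsUnit (1 + diagOp w m a) := by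
  have h : ∀ i < m, a i + -a i / (1 + a i) + a i * (-a i / (1 + a i)) = 0 := fun i hi => by
    have : 1 + a i ≠ 0 := by linarith [ha i hi]
    field_simp
    ring
  refine ⟨⟨_, 1 + diagOp w m fun i => -a i / (1 + a i), ?_, ?_⟩, rfl⟩
  · rw [one_add_diagOp_mul hw]
    exact one_add_diagOp_eq_one h
  · rw [one_add_diagOp_mul hw]
    refine one_add_diagOp_eq_one fun i hi => ?_
    rw [← h i hi]
    simp only [Pi.add_apply, Pi.mul_apply]
    ring

theorem diagOp_mem_span (w : ℕ → H) (m : ℕ) (a : ℕ → ℝ) {F : Submodule ℝ H}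
    (hF : ∀ i < m, w i ∈ F) (x : H) : diagOp w m a x ∈ F := by
  rw [diagOp_apply]
  exact F.sum_mem fun i hi => F.smul_mem _ (hF i (Finset.mem_range.1 hi))

end

section
variable {H : Type*} [NormedAddCommGroup H] [InnerProductSpace ℝ H] [CompleteSpace H]

theorem isSelfAdjoint_diagOp (w : ℕ → H) (m : ℕ) (a : ℕ → ℝ) : IsSelfAdjoint (diagOp w m a) := by
  rw [isSelfAdjoint_iff_isSymmetric]
  intro x y
  change inner ℝ (diagOp w m a x) y = inner ℝ x (diagOp w m a y)
  rw [real_inner_comm _ x, inner_diagOp, inner_diagOp]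
  exact Finset.sum_congr rfl fun i _ => by ring

theorem isPositive_one_add_diagOp {w : ℕ → H} {m : ℕ}
    (hw : Orthonormal ℝ fun i : Fin m => w i) {a : ℕ → ℝ} (ha : ∀ i < m, -1 < a i) :
    (1 + diagOp w m a).IsPositive := by
  have h := isPositive_conj_self ((IsSelfAdjoint.one _).add
    (isSelfAdjoint_diagOp w m fun i => √(1 + a i) - 1)) (isPositive_one (𝕜 := ℝ) (E := H))
  rw [mul_one, one_add_diagOp_mul hw] at h
  rwa [diagOp_congr (b := a)] at h
  intro i hi
  have := Real.mul_self_sqrt (show 0 ≤ 1 + a i by linarith [ha i hi])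
  simp only [Pi.add_apply, Pi.mul_apply]
  linear_combination this

/-- A self-adjoint operator with range in a finite-dimensional subspace `F` has an orthonormal
eigenbasis in `F`, here ordered by increasing eigenvalues. -/
theorem exists_eigenbasis {M : H →L[ℝ] H} (hM : IsSelfAdjoint M) (F : Submodule ℝ H)
    [FiniteDimensional ℝ F] (hF : ∀ x, M x ∈ F) :
    ∃ (μ : Fin (Module.finrank ℝ F) → ℝ) (b : OrthonormalBasis (Fin (Module.finrank ℝ F)) ℝ F),
      Monotone μ ∧ (∀ i, M (b i) = μ i • (b i : H)) ∧
      ∀ ν ≠ 0, (Finset.univ.filter fun i => μ i = ν).card =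
        Module.finrank ℝ (Module.End.eigenspace (M : H →ₗ[ℝ] H) ν) := by
  -- `LinearMap.IsSymmetric.eigenvalues` is antitone, hence the sign
  set T : F →ₗ[ℝ] F := -(M : H →ₗ[ℝ] H).restrict (fun x _ => hF x) with hT
  have hTapply : ∀ x : F, ((T x : F) : H) = -M x := fun x => rfl
  have hTs : T.IsSymmetric := fun x y => by
    change inner ℝ (-M x) (y : H) = inner ℝ (x : H) (-M y)
    rw [inner_neg_left, inner_neg_right]
    exact congrArg Neg.neg (hM.isSymmetric _ _)
  refine ⟨fun i => -hTs.eigenvalues rfl i, hTs.eigenvectorBasis rfl,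
    fun i j hij => neg_le_neg (hTs.eigenvalues_antitone rfl hij), fun i => ?_, fun ν hν => ?_⟩
  · have := congrArg Subtype.val (hTs.apply_eigenvectorBasis rfl i)
    rw [hTapply] at this
    rw [neg_smul, ← neg_eq_iff_eq_neg]
    exact this
  · have h1 := hTs.card_filter_eigenvalues_eq rfl (-ν)
    simp only [RCLike.ofReal_real_eq_id, id] at h1
    simp only [neg_eq_iff_eq_neg]
    rw [h1]
    have hmap : (Module.End.eigenspace T (-ν)).map F.subtype =
        Module.End.eigenspace (M : H →ₗ[ℝ] H) ν := by
      ext y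
      simp only [Submodule.mem_map, Module.End.mem_eigenspace_iff]
      constructor
      · rintro ⟨x, hx, rfl⟩
        have := congrArg Subtype.val hx
        rw [hTapply, Submodule.coe_smul, neg_smul, neg_inj] at this
        exact this
      · intro hy
        change M y = ν • y at hy
        have hyF : y ∈ F := by
          have : y = ν⁻¹ • M y := by rw [hy, smul_smul, inv_mul_cancel₀ hν, one_smul]
          rw [this]
          exact F.smul_mem _ (hF y)
        refine ⟨⟨y, hyF⟩, Subtype.ext ?_, rfl⟩
        rw [hTapply, Submodule.coe_smul, neg_smul]
        exact congrArg Neg.neg hy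
    rw [← hmap]
    exact (Submodule.equivMapOfInjective _ F.injective_subtype _).finrank_eq

omit [CompleteSpace H] in
theorem hasSum_finrank_eigenspace {M : H →L[ℝ] H} {d : ℕ} {μ : Fin d → ℝ}
    (hμ : ∀ ν ≠ 0, (Finset.univ.filter fun i => μ i = ν).card =
        Module.finrank ℝ (Module.End.eigenspace (M : H →ₗ[ℝ] H) ν)) {f : ℝ → ℝ} (hf : f 0 = 0) :
    HasSum (fun ν => (Module.finrank ℝ (Module.End.eigenspace (M : H →ₗ[ℝ] H) ν) : ℝ) * f ν)
      (∑ i, f (μ i)) := by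
  have h : ∀ ν, (Module.finrank ℝ (Module.End.eigenspace (M : H →ₗ[ℝ] H) ν) : ℝ) * f ν =
      ∑ i, if ν = μ i then f (μ i) else 0 := by
    intro ν
    rcases eq_or_ne ν 0 with rfl | hν
    · rw [hf, mul_zero]
      exact (Finset.sum_eq_zero fun i _ => by
        split_ifs with h
        · rw [← h, hf]
        · rfl).symm
    · rw [← hμ ν hν, ← Finset.sum_filter, ← nsmul_eq_mul]
      have : (Finset.univ.filter fun i => μ i = ν) = Finset.univ.filter fun i => ν = μ i :=
        Finset.filter_congr fun i _ => eq_comm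
      rw [this, ← Finset.sum_const]
      exact Finset.sum_congr rfl fun i hi => by rw [(Finset.mem_filter.1 hi).2]
  simp_rw [h]
  exact hasSum_sum fun i _ => hasSum_ite_eq (μ i) (f (μ i))

end

/-! ### Eigenvalue inequalities for low-rank perturbations -/

section
variable {H : Type*} [NormedAddCommGroup H] [InnerProductSpace ℝ H]

theorem sum_inner_mul_inner_of_mem {F : Submodule ℝ H} {ι : Type*} [Fintype ι]
    (b : OrthonormalBasis ι ℝ F) {x : H} (hx : x ∈ F) (y : H) :
    ∑ j, inner ℝ x (b j) * inner ℝ (b j : H) y = inner ℝ x y := by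
  have h := b.sum_repr' ⟨x, hx⟩
  have h' := congrArg (fun z : F => inner ℝ (z : H) y) h
  simp only [Submodule.coe_sum, Submodule.coe_smul, sum_inner, real_inner_smul_left] at h'
  rw [← h']
  refine Finset.sum_congr rfl fun j _ => ?_
  rw [real_inner_comm]
  rfl

variable {E : Type*} [NormedAddCommGroup E] [InnerProductSpace ℝ E]
variable [CompleteSpace H] [CompleteSpace E]

theorem inner_lowRankPert (Λ : H →L[ℝ] H) (N : E →L[ℝ] H) (x : H) :
    inner ℝ ((Λ + N ∘L adjoint N) x) x = inner ℝ (Λ x) x + ‖adjoint N x‖ ^ 2 := by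
  rw [add_apply, inner_add_left, comp_apply,
    ← adjoint_inner_right N, real_inner_self_eq_norm_sq]

/-- Weyl's inequality for a perturbation of rank at most `r`: the `i`-th eigenvalue of
`Λ + N N*` is at most the `(r + i)`-th eigenvalue of `Λ`. The span of the first `r + i + 1`
eigenvectors of `Λ` contains a nonzero vector in the kernel of `N*` that is orthogonal to the first
`i` eigenvectors of `Λ + N N*`. -/
theorem eigenvalue_le_of_lowRankPert [FiniteDimensional ℝ E] {w : ℕ → H} {m : ℕ} {lam : ℕ → ℝ}
    (hw : Orthonormal ℝ fun i : Fin m => w i) (hmono : Monotone lam) (N : E →L[ℝ] H) {r : ℕ}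
    (hr : Module.finrank ℝ E ≤ r) {F : Submodule ℝ H} (hwF : ∀ i < m, w i ∈ F) {d : ℕ}
    {μ : Fin d → ℝ} (hμ : Monotone μ) (b : OrthonormalBasis (Fin d) ℝ F)
    (hb : ∀ i, (diagOp w m lam + N ∘L adjoint N) (b i) = μ i • (b i : H))
    (i : Fin d) (hi : r + i < m) : μ i ≤ lam (r + i) := by
  set M := diagOp w m lam + N ∘L adjoint N with hM
  have hMsa : IsSelfAdjoint M :=
    (isSelfAdjoint_diagOp w m lam).add (isPositive_self_comp_adjoint N).isSelfAdjoint
  let w' : Fin (r + i + 1) → H := fun k => w k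
  have hw' : Orthonormal ℝ w' := hw.comp (Fin.castLE hi) (Fin.castLE_injective hi)
  let φ : (Fin (r + i + 1) → ℝ) →ₗ[ℝ] H := Fintype.linearCombination ℝ w'
  have hφ : ∀ c, φ c = ∑ k, c k • w' k := fun c => Fintype.linearCombination_apply ℝ w' c
  let Φ : (Fin (r + i + 1) → ℝ) →ₗ[ℝ] E × (Fin i → ℝ) :=
    (((adjoint N : H →L[ℝ] E) : H →ₗ[ℝ] E).prod (LinearMap.pi fun l : Fin i =>
      (innerₛₗ ℝ (b (Fin.castLE i.2.le l) : H)))) ∘ₗ φ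
  -- `Φ` maps a space of dimension `r + i + 1` to one of dimension at most `r + i`
  have hker : LinearMap.ker Φ ≠ ⊥ := LinearMap.ker_ne_bot_of_finrank_lt (by
    simp only [Module.finrank_prod, Module.finrank_fintype_fun_eq_card, Fintype.card_fin]
    omega)
  obtain ⟨c, hc, hc0⟩ := Submodule.exists_mem_ne_zero_of_ne_bot hker
  rw [LinearMap.mem_ker] at hc
  have hN : adjoint N (φ c) = 0 := congrArg Prod.fst hc
  have hbl : ∀ l : Fin d, l < i → inner ℝ (b l : H) (φ c) = 0 := fun l hl =>
    congrFun (congrArg Prod.snd hc) ⟨l, hl⟩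
  have hnorm : inner ℝ (φ c) (φ c) = ∑ k, c k * c k := by
    rw [hφ, hw'.inner_sum]; rfl
  have hpos : 0 < inner ℝ (φ c) (φ c) := by
    rw [real_inner_self_pos]
    intro h0
    rw [h0, inner_zero_left] at hnorm
    have := (Finset.sum_eq_zero_iff_of_nonneg fun k _ => mul_self_nonneg (c k)).1 hnorm.symm
    exact hc0 (funext fun k => mul_self_eq_zero.1 (this k (Finset.mem_univ k)))
  have hup : inner ℝ (M (φ c)) (φ c) ≤ lam (r + i) * inner ℝ (φ c) (φ c) := by
    rw [hM, inner_lowRankPert, hN]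
    have h1 : diagOp w m lam (φ c) = ∑ k : Fin (r + i + 1), (lam k * c k) • w' k := by
      rw [hφ, map_sum]
      refine Finset.sum_congr rfl fun k _ => ?_
      rw [map_smul, diagOp_apply_self hw lam (by omega : (k : ℕ) < m), smul_smul, mul_comm]
    rw [h1, hnorm, hφ, hw'.inner_sum, norm_zero, zero_pow two_ne_zero, add_zero, Finset.mul_sum]
    refine Finset.sum_le_sum fun k _ => ?_
    change lam k * c k * c k ≤ _
    rw [mul_assoc]
    exact mul_le_mul_of_nonneg_right (hmono (by omega)) (mul_self_nonneg _)
  have hφF : φ c ∈ F := by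
    rw [hφ]
    exact F.sum_mem fun k _ => F.smul_mem _ (hwF k (by omega))
  have hlow : μ i * inner ℝ (φ c) (φ c) ≤ inner ℝ (M (φ c)) (φ c) := by
    have h1 : inner ℝ (M (φ c)) (φ c) =
        ∑ l, μ l * (inner ℝ (φ c) (b l : H) * inner ℝ (b l : H) (φ c)) := by
      rw [← real_inner_comm, ← sum_inner_mul_inner_of_mem b hφF]
      refine Finset.sum_congr rfl fun l _ => ?_
      have : inner ℝ (b l : H) (M (φ c)) = inner ℝ (M (b l)) (φ c) := (hMsa.isSymmetric _ _).symm
      rw [this, hb, real_inner_smul_left]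
      ring
    rw [h1, ← sum_inner_mul_inner_of_mem b hφF, Finset.mul_sum]
    refine Finset.sum_le_sum fun l _ => ?_
    rcases lt_or_ge l i with hl | hl
    · rw [hbl l hl]; simp
    · rw [real_inner_comm (φ c)]
      exact mul_le_mul_of_nonneg_right (hμ hl) (mul_self_nonneg _)
  exact le_of_mul_le_mul_right (hlow.trans hup) hpos

/-- The Ky Fan inequality `∑ λₖ qₖ ≥ ∑_{k < r} λₖ` for weights `0 ≤ qₖ ≤ 1` with `∑ qₖ ≤ r`, and its
case of equality under a gap condition. It follows from
`(λₖ - λ_r) (qₖ - aₖ) ≥ 0`, where `aₖ` is `1` for `k < r` and `0` otherwise. -/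
theorem kyFan_weights {lam q : ℕ → ℝ} {m r : ℕ} (hmono : Monotone lam) (hneg : ∀ i, lam i ≤ 0)
    (hm : ∀ i, m ≤ i → lam i = 0) (hq0 : ∀ i < m, 0 ≤ q i) (hq1 : ∀ i < m, q i ≤ 1)
    (hq : ∑ i ∈ Finset.range m, q i ≤ r) :
    ∑ i ∈ Finset.range r, lam i ≤ ∑ i ∈ Finset.range m, lam i * q i ∧
    (∑ i ∈ Finset.range m, lam i * q i ≤ ∑ i ∈ Finset.range r, lam i →
      (∀ k < r, k < m → lam k < lam r) → ∀ k < m, q k = if k < r then 1 else 0) := by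
  set a : ℕ → ℝ := fun k => if k < r then 1 else 0 with ha
  have hsum : ∑ i ∈ Finset.range r, lam i = ∑ i ∈ Finset.range m, lam i * a i := by
    simp only [ha, mul_ite, mul_one, mul_zero]
    rw [← Finset.sum_filter]
    symm
    refine Finset.sum_subset (fun i hi => ?_) fun i hi hi' => ?_
    · simp at hi ⊢; omega
    · simp at hi hi'
      exact hm i (by by_contra h; exact absurd (hi' (by omega)) (by omega))
  have ha_sum : r ≤ m → ∑ i ∈ Finset.range m, a i = r := fun hrm => by
    simp only [ha]
    rw [← Finset.sum_filter]
    have : (Finset.range m).filter (fun i => i < r) = Finset.range r := by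
      ext i; simp; omega
    simp [this]
  have hterm : ∀ k < m, 0 ≤ (lam k - lam r) * (q k - a k) := fun k hk => by
    simp only [ha]
    split_ifs with h
    · exact mul_nonneg_of_nonpos_of_nonpos (sub_nonpos.2 (hmono h.le)) (by linarith [hq1 k hk])
    · exact mul_nonneg (sub_nonneg.2 (hmono (not_lt.1 h))) (by linarith [hq0 k hk])
  have hr0 : 0 ≤ lam r * (∑ i ∈ Finset.range m, q i - ∑ i ∈ Finset.range m, a i) := by
    rcases le_or_gt r m with h | h
    · rw [ha_sum h]
      exact mul_nonneg_of_nonpos_of_nonpos (hneg r) (by linarith)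
    · rw [hm r h.le, zero_mul]
  have hid : ∑ i ∈ Finset.range m, lam i * q i - ∑ i ∈ Finset.range m, lam i * a i =
      ∑ i ∈ Finset.range m, (lam i - lam r) * (q i - a i) +
        lam r * (∑ i ∈ Finset.range m, q i - ∑ i ∈ Finset.range m, a i) := by
    rw [← Finset.sum_sub_distrib, ← Finset.sum_sub_distrib, Finset.mul_sum,
      ← Finset.sum_add_distrib]
    exact Finset.sum_congr rfl fun i _ => by ring
  have hnn := Finset.sum_nonneg fun i hi => hterm i (Finset.mem_range.1 hi)
  rw [hsum]
  refine ⟨by linarith, fun hle hgap => ?_⟩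
  have hz := (Finset.sum_eq_zero_iff_of_nonneg fun i hi =>
    hterm i (Finset.mem_range.1 hi)).1 (le_antisymm (by linarith) hnn)
  have hlt : ∀ k < m, k < r → q k = 1 := fun k hk hkr => by
    have h := hz k (Finset.mem_range.2 hk)
    rcases mul_eq_zero.1 h with h | h
    · linarith [hgap k hkr hk]
    · simp only [ha, if_pos hkr] at h
      linarith
  have hle : ∀ k < m, a k ≤ q k := fun k hk => by
    simp only [ha]
    split_ifs with h
    · exact (hlt k hk h).ge
    · exact hq0 k hk
  intro k hk
  change q k = a k
  rcases lt_or_ge k r with h | h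
  · rw [hlt k hk h]; simp [ha, h]
  · have h1 := Finset.sum_nonneg fun i hi => sub_nonneg.2 (hle i (Finset.mem_range.1 hi))
    rw [Finset.sum_sub_distrib, ha_sum (by omega)] at h1
    have h2 : ∑ i ∈ Finset.range m, (q i - a i) = 0 := by
      rw [Finset.sum_sub_distrib, ha_sum (by omega)]
      linarith
    have := (Finset.sum_eq_zero_iff_of_nonneg fun i hi =>
      sub_nonneg.2 (hle i (Finset.mem_range.1 hi))).1 h2 k (Finset.mem_range.2 hk)
    linarith

/-- If the perturbation `Λ + N N*` of rank at most `r` has the eigenvalues `λ_r, λ_{r+1}, …` of `Λ`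
that remain after deletion of the first `r`, and there is a gap, then `N N*` cancels the
first `r` eigenvalues exactly. Comparing the trace of `Λ + N N*` with the trace of its compression
to the range of `N` gives equality in the Ky Fan inequality. -/
theorem lowRankPert_eq_of_eigenvalues_eq [FiniteDimensional ℝ E] {w : ℕ → H} {m : ℕ} {lam : ℕ → ℝ}
    (hw : Orthonormal ℝ fun i : Fin m => w i) (hmono : Monotone lam) (hneg : ∀ i, lam i ≤ 0)
    (hm : ∀ i, m ≤ i → lam i = 0) (N : E →L[ℝ] H) {r : ℕ}
    (hr : Module.finrank ℝ E ≤ r) {F : Submodule ℝ H} (hwF : ∀ i < m, w i ∈ F) {d : ℕ}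
    (hd : m ≤ d)
    {μ : Fin d → ℝ} (b : OrthonormalBasis (Fin d) ℝ F)
    (hF : ∀ x, (diagOp w m lam + N ∘L adjoint N) x ∈ F)
    (hb : ∀ i, (diagOp w m lam + N ∘L adjoint N) (b i) = μ i • (b i : H))
    (hμ : ∀ i, μ i = lam (r + i)) (hgap : ∀ k < r, k < m → lam k < lam r) :
    N ∘L adjoint N = diagOp w m fun k => if k < r then -lam k else 0 := by
  set M := diagOp w m lam + N ∘L adjoint N with hM
  have hMsa : IsSelfAdjoint M :=
    (isSelfAdjoint_diagOp w m lam).add (isPositive_self_comp_adjoint N).isSelfAdjoint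
  set R := LinearMap.range (N : E →ₗ[ℝ] H) with hR
  set Q := R.starProjection with hQ
  have hQN : ∀ z, Q (N z) = N z := fun z => R.starProjection_eq_self_iff.2 ⟨z, rfl⟩
  have hQs : ∀ x y, inner ℝ (Q x) y = inner ℝ x (Q y) :=
    fun x y => R.inner_starProjection_left_eq_right x y
  have hQQ : ∀ x, inner ℝ x (Q x) = ‖Q x‖ ^ 2 := fun x => by
    rw [← real_inner_self_eq_norm_sq, hQs, R.starProjection_eq_self_iff.2 (R.starProjection_apply_mem _)]
  have hw1 : ∀ k < m, ‖w k‖ = 1 := fun k hk => hw.1 ⟨k, hk⟩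
  set q : ℕ → ℝ := fun k => ‖Q (w k)‖ ^ 2 with hq
  have hq1 : ∀ k < m, q k ≤ 1 := fun k hk => by
    have : ‖Q (w k)‖ ≤ 1 := by
      rw [← hw1 k hk]; exact R.norm_starProjection_apply_le (w k)
    exact pow_le_one₀ (norm_nonneg _) this
  have hqsum : ∑ k ∈ Finset.range m, q k ≤ r := by
    let e := stdOrthonormalBasis ℝ R
    have h1 : ∀ k, q k = ∑ l, inner ℝ (w k) (e l : H) ^ 2 := fun k => by
      have h2 := sum_inner_mul_inner_of_mem e (R.starProjection_apply_mem (w k)) (Q (w k))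
      rw [real_inner_self_eq_norm_sq] at h2
      refine h2.symm.trans ?_
      refine Finset.sum_congr rfl fun l _ => ?_
      have h3 : inner ℝ (w k) (e l : H) = inner ℝ (Q (w k)) (e l : H) := by
        rw [hQs, hQ, R.starProjection_eq_self_iff.2 (e l).2]
      change inner ℝ (Q (w k)) (e l : H) * _ = _
      rw [h3, sq, real_inner_comm (Q (w k))]
    simp_rw [h1]
    rw [Finset.sum_comm]
    calc ∑ l, ∑ k ∈ Finset.range m, inner ℝ (w k) (e l : H) ^ 2 ≤ ∑ l, (1 : ℝ) := by
          refine Finset.sum_le_sum fun l _ => ?_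
          rw [Finset.sum_range]
          have := hw.sum_inner_products_le (e l : H) (s := Finset.univ)
          have he : ‖(e l : H)‖ = 1 := e.orthonormal.1 l
          rw [he] at this
          simpa using this
      _ = (Module.finrank ℝ R : ℝ) := by simp
      _ ≤ r := by exact_mod_cast (LinearMap.finrank_range_le _).trans hr
  -- the trace of `y Λ` for symmetric `y`, computed in the basis `b` and in the `wₖ`
  have hΛb : ∀ y : H → H, (∀ x z, inner ℝ (y x) z = inner ℝ x (y z)) →
      ∑ j, inner ℝ (diagOp w m lam (b j)) (y (b j)) =
        ∑ k ∈ Finset.range m, lam k * inner ℝ (w k) (y (w k)) := fun y hy => by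
    simp_rw [inner_diagOp]
    rw [Finset.sum_comm]
    refine Finset.sum_congr rfl fun k hk => ?_
    rw [← sum_inner_mul_inner_of_mem b (hwF k (Finset.mem_range.1 hk)), Finset.mul_sum]
    refine Finset.sum_congr rfl fun j _ => ?_
    rw [← hy, real_inner_comm (y (w k))]
  have hNb : ∀ j z, inner ℝ (N (adjoint N (b j))) z =
      μ j * inner ℝ (b j : H) z - inner ℝ (diagOp w m lam (b j)) z := fun j z => by
    rw [← real_inner_smul_left, ← hb j, ← inner_sub_left]
    congr 1
    change _ = diagOp w m lam (b j) + N (adjoint N (b j)) - _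
    abel
  have hbb : ∀ j, inner ℝ (b j : H) (b j : H) = 1 := fun j => by
    have : ‖(b j : H)‖ = 1 := b.orthonormal.1 j
    rw [real_inner_self_eq_norm_sq, this, one_pow]
  -- two evaluations of the trace of `N N* = Q N N*`, from `N N* = M - Λ`
  have htr : ∑ j, inner ℝ (N (adjoint N (b j))) (b j : H) =
      ∑ j, μ j - ∑ k ∈ Finset.range m, lam k := by
    simp_rw [hNb, Finset.sum_sub_distrib]
    congr 1
    · exact Finset.sum_congr rfl fun j _ => by rw [hbb, mul_one]
    · refine (hΛb id fun _ _ => rfl).trans (Finset.sum_congr rfl fun k hk => ?_)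
      rw [id, real_inner_self_eq_norm_sq, hw1 k (Finset.mem_range.1 hk), one_pow, mul_one]
  have htrQ : ∑ j, inner ℝ (N (adjoint N (b j))) (b j : H) =
      ∑ j, μ j * ‖Q (b j)‖ ^ 2 - ∑ k ∈ Finset.range m, lam k * q k := by
    have h1 : ∀ j, inner ℝ (N (adjoint N (b j))) (b j : H) =
        inner ℝ (N (adjoint N (b j))) (Q (b j)) := fun j => by rw [← hQs, hQN]
    simp_rw [h1, hNb, Finset.sum_sub_distrib, hΛb Q hQs, hQQ]
    rfl
  have hμsum : ∑ j, μ j = ∑ k ∈ Finset.range m, lam k - ∑ k ∈ Finset.range r, lam k := by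
    have h1 : ∑ k ∈ Finset.range m, lam k = ∑ k ∈ Finset.range (r + d), lam k :=
      Finset.sum_subset (Finset.range_mono (by omega)) fun k _ hk =>
        hm k (by simpa using hk)
    rw [h1, Finset.sum_range_add, add_sub_cancel_left, Finset.sum_range]
    exact Finset.sum_congr rfl fun j _ => hμ j
  -- `∑ λₖ qₖ - ∑_{k < r} λₖ` is nonnegative by Ky Fan and equals the nonpositive `∑ μⱼ ‖Q bⱼ‖²`
  obtain ⟨hKF, hKFeq⟩ := kyFan_weights hmono hneg hm (fun k _ => sq_nonneg ‖Q (w k)‖) hq1 hqsum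
  have hterm : ∀ j, μ j * ‖Q (b j)‖ ^ 2 ≤ 0 := fun j =>
    mul_nonpos_of_nonpos_of_nonneg (hμ j ▸ hneg _) (sq_nonneg _)
  have hnonpos : ∑ j, μ j * ‖Q (b j)‖ ^ 2 ≤ 0 := Finset.sum_nonpos fun j _ => hterm j
  have hzero : ∀ j, μ j • Q (b j) = 0 := fun j => by
    have h := (Finset.sum_eq_zero_iff_of_nonpos fun j _ => hterm j).1
      (le_antisymm hnonpos (by linarith)) j (Finset.mem_univ j)
    rcases mul_eq_zero.1 h with h | h
    · rw [h, zero_smul]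
    · rw [norm_eq_zero.1 (pow_eq_zero_iff two_ne_zero |>.1 h), smul_zero]
  have hqa := hKFeq (by linarith) hgap
  have hQw : ∀ k < m, Q (w k) = (if k < r then (1 : ℝ) else 0) • w k := fun k hk => by
    have h := hqa k hk
    split_ifs at h ⊢ with hkr
    · rw [one_smul, ← sub_eq_zero, ← norm_eq_zero, ← pow_eq_zero_iff two_ne_zero,
        norm_sub_sq_real, real_inner_comm, hQQ, h, hw1 k hk]
      norm_num
    · rw [zero_smul]
      exact norm_eq_zero.1 (pow_eq_zero_iff two_ne_zero |>.1 h)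
  have hQM : ∀ x, Q (M x) = 0 := fun x => by
    have h1 := congrArg (fun z : F => Q (z : H)) (b.sum_repr' ⟨M x, hF x⟩)
    simp only [Submodule.coe_sum, Submodule.coe_smul, map_sum, map_smul] at h1
    rw [← h1]
    refine Finset.sum_eq_zero fun j _ => ?_
    have h2 : inner ℝ (b j) (⟨M x, hF x⟩ : F) = μ j * inner ℝ (b j : H) x := by
      rw [← real_inner_smul_left, ← hb j]
      exact (hMsa.isSymmetric _ _).symm
    rw [h2, mul_comm, mul_smul, hzero, smul_zero]
  ext x
  have h1 : N (adjoint N x) = Q (M x) - Q (diagOp w m lam x) := by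
    rw [← map_sub, hM]
    change _ = Q (diagOp w m lam x + N (adjoint N x) - diagOp w m lam x)
    rw [add_sub_cancel_left, hQN]
  rw [comp_apply, h1, hQM, zero_sub, diagOp_apply, diagOp_apply, map_sum, ← Finset.sum_neg_distrib]
  refine Finset.sum_congr rfl fun k hk => ?_
  rw [map_smul, hQw k (Finset.mem_range.1 hk), smul_smul, ← neg_smul]
  congr 1
  split_ifs <;> ring

end

/-! ### Losses of low-rank covariances -/

theorem strictAntiOn_of_mem_spectralFunctions {f : ℝ → ℝ} (hf : f ∈ spectralFunctions) :
    StrictAntiOn f (Set.Ioc (-1) 0) := by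
  refine strictAntiOn_of_deriv_neg (convex_Ioc _ _)
    (hf.1.continuousOn.mono fun x hx => hx.1) fun x hx => ?_
  rw [interior_Ioc] at hx
  have := hf.2.2.1 x hx.1 hx.2.ne
  exact (neg_iff_neg_of_mul_pos this).1 hx.2

theorem pos_of_mem_spectralFunctions {f : ℝ → ℝ} (hf : f ∈ spectralFunctions) {x : ℝ}
    (hx : -1 < x) (hx0 : x ≠ 0) : 0 < f x := by
  rw [← hf.2.1]
  rcases lt_or_gt_of_ne hx0 with h | h
  · exact strictAntiOn_of_mem_spectralFunctions hf ⟨hx, h.le⟩ ⟨by norm_num, le_rfl⟩ h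
  · have : StrictMonoOn f (Set.Ici 0) := by
      refine strictMonoOn_of_deriv_pos (convex_Ici _)
        (hf.1.continuousOn.mono fun x hx => ?_) fun x hx => ?_
      · exact lt_of_lt_of_le (by norm_num) (Set.mem_Ici.1 hx)
      · rw [interior_Ici] at hx
        have hx' : 0 < x := hx
        exact (pos_iff_pos_of_mul_pos (hf.2.2.1 x (by linarith) hx'.ne')).1 hx'
    exact this (Set.mem_Ici.2 le_rfl) (Set.mem_Ici.2 h.le) h

theorem sq_mem_spectralFunctions : (fun x : ℝ => x ^ 2) ∈ spectralFunctions := by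
  have hd : ∀ x : ℝ, deriv (fun x : ℝ => x ^ 2) x = 2 * x := fun x => by simp
  refine ⟨(contDiff_id.pow 2).contDiffOn, by simp, fun x _ hx => ?_,
    Filter.tendsto_pow_atTop two_ne_zero, 2, 1, one_pos, fun x _ => ?_⟩
  · rw [hd]
    have : 0 < x ^ 2 := by positivity
    linarith
  · rw [hd, hd, mul_zero, sub_zero, abs_mul]
    simp

section
variable {H : Type*} [NormedAddCommGroup H] [InnerProductSpace ℝ H]

theorem card_eq_finrank_eigenspace_diagOp {w : ℕ → H} {m : ℕ}
    (hw : Orthonormal ℝ fun i : Fin m => w i) (a : ℕ → ℝ) {ν : ℝ} (hν : ν ≠ 0) :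
    (Finset.univ.filter fun i : Fin m => a i = ν).card =
      Module.finrank ℝ (Module.End.eigenspace (diagOp w m a : H →ₗ[ℝ] H) ν) := by
  let v : {i : Fin m // a i = ν} → H := fun i => w i
  have hv : LinearIndependent ℝ v :=
    (hw.comp (fun i : {i : Fin m // a i = ν} => (i : Fin m)) Subtype.val_injective).linearIndependent
  have hspan : Module.End.eigenspace (diagOp w m a : H →ₗ[ℝ] H) ν =
      Submodule.span ℝ (Set.range v) := by
    ext x
    rw [Module.End.mem_eigenspace_iff]
    constructor
    · intro hx
      change diagOp w m a x = ν • x at hx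
      have h1 : x = ν⁻¹ • diagOp w m a x := by rw [hx, smul_smul, inv_mul_cancel₀ hν, one_smul]
      rw [h1, diagOp_apply]
      refine Submodule.smul_mem _ _ (Submodule.sum_mem _ fun i hi => ?_)
      have him := Finset.mem_range.1 hi
      by_cases hai : a i = ν
      · exact Submodule.smul_mem _ _ (Submodule.subset_span ⟨⟨⟨i, him⟩, hai⟩, rfl⟩)
      · have h2 : inner ℝ (w i) (diagOp w m a x) = a i * inner ℝ (w i) x := by
          have h3 := inner_diagOp w m a (w i) x
          rw [diagOp_apply_self hw a him, real_inner_smul_left] at h3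
          rw [h3, real_inner_comm, inner_diagOp]
          exact Finset.sum_congr rfl fun j _ => by ring
        rw [hx, real_inner_smul_right] at h2
        have : inner ℝ (w i) x = 0 := by
          by_contra h0
          exact hai (mul_right_cancel₀ h0 h2).symm
        rw [this, mul_zero, zero_smul]
        exact Submodule.zero_mem _
    · intro hx
      rw [← Module.End.mem_eigenspace_iff]
      refine Submodule.span_le.2 ?_ hx
      rintro _ ⟨i, rfl⟩
      rw [SetLike.mem_coe, Module.End.mem_eigenspace_iff]
      change diagOp w m a (w i) = ν • w i
      rw [diagOp_apply_self hw a i.1.2, i.2]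
  rw [hspan, finrank_span_eq_card hv, Fintype.card_subtype]

variable [CompleteSpace H]

/-- The data to which the inverse problem reduces: `S = C_pr^{1/2}`, the negative numbers among the
`λᵢ`, which are `λ₀ ≤ … ≤ λ_{m-1}`, and corresponding orthonormal vectors `w₀, …, w_{m-1}`. The
posterior covariance is `S (1 + ∑_{i < m} λᵢ wᵢ ⊗ wᵢ) S`. -/
structure SpectralData (S : H →L[ℝ] H) (lam : ℕ → ℝ) (w : ℕ → H) (m : ℕ) : Prop where
  isSelfAdjoint : IsSelfAdjoint S
  injective : Function.Injective S
  hasFiniteTrace : HasFiniteTrace (S * S)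
  orthonormal : Orthonormal ℝ fun i : Fin m => w i
  mono : Monotone lam
  mem_Ioc : ∀ i, lam i ∈ Set.Ioc (-1 : ℝ) 0
  neg : ∀ i < m, lam i < 0
  eq_zero : ∀ i, m ≤ i → lam i = 0

namespace SpectralData

variable {S : H →L[ℝ] H} {lam : ℕ → ℝ} {w : ℕ → H} {m : ℕ}

/-- The square root of `1 + ∑_{i < m} λᵢ wᵢ ⊗ wᵢ`. -/
def sqrtFactor (lam : ℕ → ℝ) (w : ℕ → H) (m : ℕ) : H →L[ℝ] H :=
  1 + diagOp w m fun i => √(1 + lam i) - 1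

theorem sqrtFactor_mul_self (h : SpectralData S lam w m) :
    sqrtFactor lam w m * sqrtFactor lam w m = 1 + diagOp w m lam := by
  rw [sqrtFactor, one_add_diagOp_mul h.orthonormal]
  congr 1
  refine diagOp_congr fun i _ => ?_
  have := Real.mul_self_sqrt (show 0 ≤ 1 + lam i by linarith [(h.mem_Ioc i).1])
  simp only [Pi.add_apply, Pi.mul_apply]
  linear_combination this

theorem neg_one_lt_sqrt_sub (h : SpectralData S lam w m) (i : ℕ) : -1 < √(1 + lam i) - 1 := by
  have := Real.sqrt_pos.2 (show 0 < 1 + lam i by linarith [(h.mem_Ioc i).1])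
  linarith

theorem isPositive_sqrtFactor (h : SpectralData S lam w m) : (sqrtFactor lam w m).IsPositive :=
  isPositive_one_add_diagOp h.orthonormal fun i _ => h.neg_one_lt_sqrt_sub i

theorem isUnit_sqrtFactor (h : SpectralData S lam w m) : IsUnit (sqrtFactor lam w m) :=
  isUnit_one_add_diagOp h.orthonormal fun i _ => h.neg_one_lt_sqrt_sub i

variable {E : Type*} [NormedAddCommGroup E] [InnerProductSpace ℝ E] [CompleteSpace E]

theorem relOp_eq (h : SpectralData S lam w m) (U : E →L[ℝ] H) :
    relOp S (sqrtFactor lam w m) U = diagOp w m lam +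
      (sqrtFactor lam w m ∘L S ∘L U) ∘L adjoint (sqrtFactor lam w m ∘L S ∘L U) := by
  set V := sqrtFactor lam w m with hV
  have h1 : (V ∘L S ∘L U) ∘L adjoint (V ∘L S ∘L U) = V * (S * (U ∘L adjoint U) * S) * V := by
    rw [adjoint_comp_selfAdjoint h.isPositive_sqrtFactor.isSelfAdjoint,
      adjoint_comp_selfAdjoint h.isSelfAdjoint]
    rfl
  rw [h1, relOp, mul_add, add_mul, mul_one, h.sqrtFactor_mul_self]
  abel

/-- The operator `relOp` has finite rank. A list `μ` of its eigenvalues with multiplicity, in which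
the multiplicity of `0` is arbitrary, can be chosen with at least `m` members. They exceed `-1` and
satisfy Weyl's inequality, and under the gap condition they equal the shifted `λᵢ` only for the
optimal operator. -/
theorem exists_eigenvalues (h : SpectralData S lam w m) [FiniteDimensional ℝ E]
    {r : ℕ} (hr : Module.finrank ℝ E ≤ r) (U : E →L[ℝ] H) :
    FiniteDimensional ℝ (LinearMap.range (relOp S (sqrtFactor lam w m) U : H →ₗ[ℝ] H)) ∧
    ∃ (d : ℕ) (μ : Fin d → ℝ), m ≤ d ∧
      (∀ ν ≠ 0, (Finset.univ.filter fun i => μ i = ν).card = Module.finrank ℝ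
        (Module.End.eigenspace (relOp S (sqrtFactor lam w m) U : H →ₗ[ℝ] H) ν)) ∧
      (∀ i, -1 < μ i) ∧ (∀ i : Fin d, r + (i : ℕ) < m → μ i ≤ lam (r + i)) ∧
      ((∀ i : Fin d, μ i = lam (r + i)) → (∀ k < r, k < m → lam k < lam r) →
        relOp S (sqrtFactor lam w m) U = diagOp w m fun k => if k < r then 0 else lam k) := by
  rw [h.relOp_eq]
  have hVinj := injective_of_isUnit h.isUnit_sqrtFactor
  set N := sqrtFactor lam w m ∘L S ∘L U with hN
  set M := diagOp w m lam + N ∘L adjoint N with hM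
  let F : Submodule ℝ H := Submodule.span ℝ (Set.range fun i : Fin m => w i) ⊔
    LinearMap.range (N : E →ₗ[ℝ] H)
  have hwF : ∀ i < m, w i ∈ F := fun i hi =>
    Submodule.mem_sup_left (Submodule.subset_span ⟨⟨i, hi⟩, rfl⟩)
  have hF : ∀ x, M x ∈ F := fun x =>
    F.add_mem (diagOp_mem_span w m lam hwF x) (Submodule.mem_sup_right ⟨adjoint N x, rfl⟩)
  have : FiniteDimensional ℝ F := by
    have := FiniteDimensional.span_of_finite ℝ (Set.finite_range fun i : Fin m => w i)
    exact Submodule.finite_sup _ _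
  have hMsa : IsSelfAdjoint M :=
    (isSelfAdjoint_diagOp w m lam).add (isPositive_self_comp_adjoint N).isSelfAdjoint
  obtain ⟨μ, b, hmono, hb, hcard⟩ := exists_eigenbasis hMsa F hF
  have hmd : m ≤ Module.finrank ℝ F := by
    have hli : LinearIndependent ℝ fun i : Fin m => (⟨w i, hwF i i.2⟩ : F) :=
      LinearIndependent.of_comp F.subtype h.orthonormal.linearIndependent
    simpa using hli.fintype_card_le_finrank
  refine ⟨Submodule.finiteDimensional_of_le (S₂ := F) (by rintro _ ⟨x, rfl⟩; exact hF x),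
    _, μ, hmd, hcard, fun i => ?_, fun i hi => ?_, fun hμ hgap => ?_⟩
  · have h1 : 0 < inner ℝ ((1 + M) (b i)) (b i : H) := by
      have hb0 : (b i : H) ≠ 0 := fun h0 => by
        have : ‖(b i : H)‖ = 1 := b.orthonormal.1 i
        rw [h0, norm_zero] at this
        exact zero_ne_one this
      rw [hM, ← add_assoc, ← h.sqrtFactor_mul_self, inner_lowRankPert]
      have h2 : inner ℝ ((sqrtFactor lam w m * sqrtFactor lam w m) (b i)) (b i : H) =
          inner ℝ (sqrtFactor lam w m (b i)) (sqrtFactor lam w m (b i)) :=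
        h.isPositive_sqrtFactor.isSelfAdjoint.isSymmetric _ _
      rw [h2]
      have h3 : 0 < inner ℝ (sqrtFactor lam w m (b i)) (sqrtFactor lam w m (b i)) :=
        real_inner_self_pos.2 fun h0 => hb0 (hVinj (h0.trans (map_zero _).symm))
      positivity
    rw [add_apply, one_apply_eq_self, hb, inner_add_left, real_inner_smul_left,
      real_inner_self_eq_norm_sq] at h1
    have : ‖(b i : H)‖ = 1 := b.orthonormal.1 i
    rw [this] at h1
    linarith
  · exact eigenvalue_le_of_lowRankPert h.orthonormal h.mono N hr hwF hmono b hb i hi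
  · rw [hM, lowRankPert_eq_of_eigenvalues_eq h.orthonormal h.mono (fun i => (h.mem_Ioc i).2)
      h.eq_zero N hr hwF hmd b hF hb hμ hgap, ← diagOp_add]
    refine diagOp_congr fun k _ => ?_
    simp only [Pi.add_apply]
    split_ifs <;> ring

theorem hasSum_shift (h : SpectralData S lam w m) {f : ℝ → ℝ} (hf : f 0 = 0) (r : ℕ) {d : ℕ}
    (hd : m ≤ d) : HasSum (fun i => f (lam (r + i))) (∑ i : Fin d, f (lam (r + i))) := by
  rw [← Finset.sum_range fun i => f (lam (r + i))]
  refine hasSum_sum_of_ne_finset_zero fun i hi => ?_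
  rw [h.eq_zero _ (by simp at hi; omega), hf]

/-- Every competitor `lowRankCov S U` is admissible and has finite loss, the loss is at least
`∑_{i ≥ r} f (λᵢ)`, and under the gap condition this value determines the competitor. -/
theorem lowRankCov_loss (h : SpectralData S lam w m) [FiniteDimensional ℝ E]
    {r : ℕ} (hr : Module.finrank ℝ E ≤ r) (U : E →L[ℝ] H) {Cpos : H →L[ℝ] H}
    (hCpos : Cpos = S * (1 + diagOp w m lam) * S) :
    lowRankCov S U ∈ equivalentCovs Cpos ∧
    ∀ f ∈ spectralFunctions, Summable (lossTerm f Cpos (lowRankCov S U)) ∧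
      ∀ L, HasSum (fun i => f (lam (r + i))) L → L ≤ spectralLoss f Cpos (lowRankCov S U) ∧
        (spectralLoss f Cpos (lowRankCov S U) ≤ L → (∀ k < r, k < m → lam k < lam r) →
          lowRankCov S U = S * (1 + diagOp w m fun k => if k < r then lam k else 0) * S) := by
  obtain ⟨hfin, d, μ, hmd, hcard, hμ1, hμle, hμeq⟩ := h.exists_eigenvalues hr U
  have hprop := lowRankCov_properties h.isSelfAdjoint h.injective h.hasFiniteTrace
    h.isPositive_sqrtFactor h.isUnit_sqrtFactor U hfin
  rw [h.sqrtFactor_mul_self, ← hCpos] at hprop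
  refine ⟨hprop.1, fun f hf => ?_⟩
  have hterm : lossTerm f Cpos (lowRankCov S U) = fun ν => _ := funext fun ν => hprop.2 f ν
  have hsum := hasSum_finrank_eigenspace hcard hf.2.1
  rw [← hterm] at hsum
  have hanti := strictAntiOn_of_mem_spectralFunctions hf
  have hf0 : ∀ x, -1 < x → 0 ≤ f x := fun x hx => by
    rcases eq_or_ne x 0 with rfl | hx0
    · exact hf.2.1.ge
    · exact (pos_of_mem_spectralFunctions hf hx hx0).le
  have hle : ∀ i : Fin d, f (lam (r + i)) ≤ f (μ i) := fun i => by
    rcases lt_or_ge (r + (i : ℕ)) m with hi | hi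
    · exact hanti.antitoneOn ⟨hμ1 i, (hμle i hi).trans (h.mem_Ioc _).2⟩ (h.mem_Ioc _) (hμle i hi)
    · rw [h.eq_zero _ hi, hf.2.1]
      exact hf0 _ (hμ1 i)
  refine ⟨hsum.summable, fun L hL => ?_⟩
  rw [hL.unique (h.hasSum_shift hf.2.1 r hmd), spectralLoss, hsum.tsum_eq]
  refine ⟨Finset.sum_le_sum fun i _ => hle i, fun hge hgap => ?_⟩
  have heq := (Finset.sum_eq_sum_iff_of_le fun i _ => hle i).1
    (le_antisymm (Finset.sum_le_sum fun i _ => hle i) hge)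
  have hμ : ∀ i : Fin d, μ i = lam (r + i) := fun i => by
    have hi' := heq i (Finset.mem_univ i)
    rcases lt_or_ge (r + (i : ℕ)) m with hi | hi
    · exact (hanti.injOn (h.mem_Ioc _) ⟨hμ1 i, (hμle i hi).trans (h.mem_Ioc _).2⟩ hi').symm
    · rw [h.eq_zero _ hi] at hi' ⊢
      rw [hf.2.1] at hi'
      by_contra hne
      exact (pos_of_mem_spectralFunctions hf (hμ1 i) hne).ne hi'
  have hrel := hμeq hμ hgap
  set V := sqrtFactor lam w m with hV
  set D := 1 + S * (U ∘L adjoint U) * S with hD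
  set X := 1 + diagOp w m fun k => if k < r then lam k else 0 with hX
  have hVDV : V * D * V = 1 + diagOp w m fun k => if k < r then 0 else lam k := by
    rw [← hrel, relOp, ← hD]; abel
  have hcomm : V * X = X * V := by
    rw [hV, sqrtFactor, hX, one_add_diagOp_mul h.orthonormal, one_add_diagOp_mul h.orthonormal]
    congr 2
    ring
  -- `(1 + ∑_{k ≥ r} λₖ wₖ ⊗ wₖ) (1 + ∑_{k < r} λₖ wₖ ⊗ wₖ) = 1 + Λ`, hence `D X = 1`
  have h1 : V * D * V * X = V * V := by
    rw [hVDV, hX, one_add_diagOp_mul h.orthonormal, h.sqrtFactor_mul_self]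
    congr 1
    refine diagOp_congr fun k _ => ?_
    simp only [Pi.add_apply, Pi.mul_apply]
    split_ifs <;> ring
  refine lowRankCov_eq_of_mul_eq_one h.isSelfAdjoint ?_
  refine h.isUnit_sqrtFactor.mul_left_cancel (h.isUnit_sqrtFactor.mul_right_cancel ?_)
  rw [← hV, ← hD, mul_one, ← h1, mul_assoc (V * D), hcomm]
  simp only [mul_assoc]

/-- The loss of the competitor in which the first `r` of the `λᵢ` are cancelled. -/
theorem hasSum_spectralLoss_opt (h : SpectralData S lam w m) {r : ℕ} (U : E →L[ℝ] H)
    {Cpos : H →L[ℝ] H} (hCpos : Cpos = S * (1 + diagOp w m lam) * S)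
    (hU : S * (U ∘L adjoint U) * S =
      diagOp w m fun k => if k < r then -lam k / (1 + lam k) else 0) {f : ℝ → ℝ}
    (hf : f 0 = 0) :
    HasSum (fun i => f (lam (r + i))) (spectralLoss f Cpos (lowRankCov S U)) := by
  have hrel : relOp S (sqrtFactor lam w m) U =
      diagOp w m fun k => if k < r then 0 else lam k := by
    rw [relOp, hU, sqrtFactor, one_add_diagOp_mul h.orthonormal, one_add_diagOp_mul h.orthonormal,
      add_sub_cancel_left]
    refine diagOp_congr fun k _ => ?_
    have h1 : 0 < 1 + lam k := by linarith [(h.mem_Ioc k).1]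
    have := Real.mul_self_sqrt h1.le
    simp only [Pi.add_apply, Pi.mul_apply]
    split_ifs
    · field_simp
      linear_combination this
    · linear_combination this
  have hfin : FiniteDimensional ℝ
      (LinearMap.range (relOp S (sqrtFactor lam w m) U : H →ₗ[ℝ] H)) := by
    have := FiniteDimensional.span_of_finite ℝ (Set.finite_range fun i : Fin m => w i)
    refine Submodule.finiteDimensional_of_le
      (S₂ := Submodule.span ℝ (Set.range fun i : Fin m => w i)) ?_
    rintro _ ⟨x, rfl⟩
    rw [hrel]
    exact diagOp_mem_span w m _ (fun i hi => Submodule.subset_span (Set.mem_range.2 ⟨⟨i, hi⟩, rfl⟩)) x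
  have hprop := lowRankCov_properties h.isSelfAdjoint h.injective h.hasFiniteTrace
    h.isPositive_sqrtFactor h.isUnit_sqrtFactor U hfin
  rw [h.sqrtFactor_mul_self, ← hCpos, hrel] at hprop
  have hterm : lossTerm f Cpos (lowRankCov S U) = fun ν => _ := funext fun ν => hprop.2 f ν
  have hsum := hasSum_finrank_eigenspace (M := diagOp w m fun k => if k < r then 0 else lam k)
    (fun ν hν => card_eq_finrank_eigenspace_diagOp h.orthonormal _ hν) hf
  rw [← hterm] at hsum
  rw [spectralLoss, hsum.tsum_eq]
  have h1 : HasSum (fun k => f (if k < r then 0 else lam k))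
      (∑ i : Fin m, f (if (i : ℕ) < r then 0 else lam i)) := by
    rw [← Finset.sum_range fun i => f (if i < r then 0 else lam i)]
    refine hasSum_sum_of_ne_finset_zero fun i hi => ?_
    rw [h.eq_zero _ (by simpa using hi), ite_self, hf]
  have h2 := (hasSum_nat_add_iff' r).2 h1
  have h3 : ∑ i ∈ Finset.range r, f (if i < r then 0 else lam i) = 0 :=
    Finset.sum_eq_zero fun i hi => by rw [if_pos (Finset.mem_range.1 hi), hf]
  rw [h3, sub_zero] at h2
  simpa [add_comm] using h2

end SpectralData
end

/-! ### The inverse problem -/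

section
variable {H : Type*} [NormedAddCommGroup H] [InnerProductSpace ℝ H]

theorem IsONBSeq.inner_eq_zero {w : ℕ → H} (hw : IsONBSeq w) {i j : ℕ} (hij : i ≠ j) :
    inner ℝ (w i) (w j) = 0 := by
  by_cases hi : w i = 0
  · rw [hi, inner_zero_left]
  by_cases hj : w j = 0
  · rw [hj, inner_zero_right]
  exact hw.orthonormal.2 (i := ⟨i, hi⟩) (j := ⟨j, hj⟩) (by simpa using hij)

theorem IsONBSeq.orthonormal_comp {w : ℕ → H} (hw : IsONBSeq w) {ι : Type*} {g : ι → ℕ}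
    (hg : Function.Injective g) (h0 : ∀ i, w (g i) ≠ 0) : Orthonormal ℝ fun i => w (g i) :=
  hw.orthonormal.comp (fun i => (⟨g i, h0 i⟩ : {i : ℕ // w i ≠ 0}))
    fun _ _ h => hg (congrArg Subtype.val h)

theorem sum_range_smul_rankOne_eq_diagOp {w : ℕ → H} {m : ℕ} {a : ℕ → ℝ}
    (ha : ∀ i, m ≤ i → a i = 0) (r : ℕ) :
    ∑ i ∈ Finset.range r, a i • InnerProductSpace.rankOne ℝ (w i) (w i) =
      diagOp w m fun k => if k < r then a k else 0 := by
  simp only [diagOp, ite_smul, zero_smul]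
  rw [← Finset.sum_filter]
  symm
  refine Finset.sum_subset (fun i hi => ?_) fun i hi hi' => ?_
  · simp at hi ⊢; omega
  · rw [ha i (by simp at hi hi'; by_contra h; exact absurd (hi' (by omega)) (by omega)), zero_smul]

variable [CompleteSpace H]

theorem conj_rankOne {S : H →L[ℝ] H} (hS : IsSelfAdjoint S) (x : H) :
    S * InnerProductSpace.rankOne ℝ x x * S = InnerProductSpace.rankOne ℝ (S x) (S x) := by
  ext y
  change S (inner ℝ x (S y) • x) = inner ℝ (S x) y • S x
  rw [map_smul]
  congr 1
  exact (hS.isSymmetric x y).symm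

theorem exists_comp_adjoint_eq_sum (v : ℕ → H) {c : ℕ → ℝ} (hc : ∀ i, 0 ≤ c i) (r : ℕ) :
    ∃ U : EuclideanSpace ℝ (Fin r) →L[ℝ] H,
      U ∘L adjoint U = ∑ i ∈ Finset.range r, c i • InnerProductSpace.rankOne ℝ (v i) (v i) := by
  let e := EuclideanSpace.basisFun (Fin r) ℝ
  let U : EuclideanSpace ℝ (Fin r) →L[ℝ] H :=
    ∑ i : Fin r, √(c i) • InnerProductSpace.rankOne ℝ (v i) (e i)
  have hUe : ∀ i : Fin r, U (e i) = √(c i) • v i := fun i => by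
    have h : ∀ j : Fin r, inner ℝ (e j) (e i) = if j = i then (1 : ℝ) else 0 :=
      fun j => orthonormal_iff_ite.1 e.orthonormal j i
    simp [U, h]
  have hUs : adjoint U = ∑ i : Fin r, √(c i) • InnerProductSpace.rankOne ℝ (e i) (v i) := by
    simp [U]
  refine ⟨U, ?_⟩
  ext x
  rw [comp_apply, hUs, Finset.sum_range]
  simp only [sum_apply, smul_apply, InnerProductSpace.rankOne_apply, map_sum, map_smul, hUe]
  refine Finset.sum_congr rfl fun i _ => ?_
  rw [smul_smul, smul_smul, smul_smul]
  congr 1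
  linear_combination (inner ℝ (v i) x) * Real.mul_self_sqrt (hc i)

variable {n : ℕ} {G : H →L[ℝ] EuclideanSpace ℝ (Fin n)}
  {Cobs : EuclideanSpace ℝ (Fin n) →L[ℝ] EuclideanSpace ℝ (Fin n)} {Cpr : H →L[ℝ] H}
  {lam : ℕ → ℝ} {w : ℕ → H}

theorem IsEigenSystem.apply_eigenvector (hw : IsEigenSystem G Cobs Cpr lam w) {j : ℕ}
    (hj : w j ≠ 0) : (opSqrt Cpr ∘L hessian G Cobs ∘L opSqrt Cpr) (w j) =
      (-lam j / (1 + lam j)) • w j := by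
  refine (hw.hasSum (w j)).unique ?_
  have h1 : ‖w j‖ = 1 := hw.onb.orthonormal.1 ⟨j, hj⟩
  have h2 : (-lam j / (1 + lam j)) • InnerProductSpace.rankOne ℝ (w j) (w j) (w j) =
      (-lam j / (1 + lam j)) • w j := by
    rw [InnerProductSpace.rankOne_apply, real_inner_self_eq_norm_sq, h1, one_pow, one_smul]
  rw [← h2]
  refine hasSum_single j fun i hij => ?_
  rw [InnerProductSpace.rankOne_apply, hw.onb.inner_eq_zero hij, zero_smul, smul_zero]

/-- Since the Hessian factors through `ℝⁿ`, not all `λᵢ` are nonzero. -/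
theorem IsEigenSystem.exists_eq_zero (hw : IsEigenSystem G Cobs Cpr lam w) : ∃ i, lam i = 0 := by
  by_contra! hne
  have hw0 : ∀ i, w i ≠ 0 := fun i h0 => hne i (hw.pad i h0)
  have horth : Orthonormal ℝ fun i : Fin (n + 1) => w i :=
    hw.onb.orthonormal_comp Fin.val_injective fun i => hw0 i
  have hc : ∀ i, -lam i / (1 + lam i) ≠ 0 := fun i =>
    div_ne_zero (neg_ne_zero.2 (hne i)) (by linarith [(hw.mem_Ioc i).1])
  let z : Fin (n + 1) → EuclideanSpace ℝ (Fin n) := fun i => Ring.inverse Cobs (G (opSqrt Cpr (w i)))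
  have hz : LinearIndependent ℝ z := by
    refine LinearIndependent.of_comp
      ((opSqrt Cpr ∘L adjoint G : EuclideanSpace ℝ (Fin n) →L[ℝ] H) : _ →ₗ[ℝ] H) ?_
    have : ((opSqrt Cpr ∘L adjoint G : EuclideanSpace ℝ (Fin n) →L[ℝ] H) : _ →ₗ[ℝ] H) ∘ z =
        (fun i : Fin (n + 1) => Units.mk0 _ (hc i)) • fun i : Fin (n + 1) => w i := by
      funext i
      exact hw.apply_eigenvector (hw0 i)
    rw [this]
    exact horth.linearIndependent.units_smul _
  have := hz.fintype_card_le_finrank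
  simp at this

theorem IsEigenSystem.exists_spectralData (hw : IsEigenSystem G Cobs Cpr lam w)
    (hCobs : IsStrictlyPos Cobs) (hCpr : IsStrictlyPos Cpr) (htr : HasFiniteTrace Cpr) :
    ∃ m, SpectralData (opSqrt Cpr) lam w m ∧
      posteriorCov G Cobs Cpr = opSqrt Cpr * (1 + diagOp w m lam) * opSqrt Cpr := by
  classical
  obtain ⟨hS, hSS⟩ := opSqrt_spec hCpr.isPositive
  set m := Nat.find hw.exists_eq_zero with hm
  have hneg : ∀ i < m, lam i < 0 := fun i hi =>
    lt_of_le_of_ne (hw.mem_Ioc i).2 (Nat.find_min hw.exists_eq_zero hi)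
  have hzero : ∀ i, m ≤ i → lam i = 0 := fun i hi =>
    le_antisymm (hw.mem_Ioc i).2
      ((Nat.find_spec hw.exists_eq_zero).symm.le.trans (hw.mono hi))
  have horth : Orthonormal ℝ fun i : Fin m => w i :=
    hw.onb.orthonormal_comp Fin.val_injective fun i h0 => (hneg i i.2).ne (hw.pad i h0)
  refine ⟨m, ⟨hS.isSelfAdjoint, injective_opSqrt hCpr.isPositive hCpr.injective,
    by rwa [hSS], horth, hw.mono, hw.mem_Ioc, hneg, hzero⟩, ?_⟩
  refine posteriorCov_eq G hCobs hS.isSelfAdjoint hSS ?_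
  have hT : opSqrt Cpr ∘L hessian G Cobs ∘L opSqrt Cpr =
      diagOp w m fun i => -lam i / (1 + lam i) := by
    ext x
    refine (hw.hasSum x).unique ?_
    have : diagOp w m (fun i => -lam i / (1 + lam i)) x = ∑ i ∈ Finset.range m,
        (-lam i / (1 + lam i)) • InnerProductSpace.rankOne ℝ (w i) (w i) x := by
      simp [diagOp]
    rw [this]
    refine hasSum_sum_of_ne_finset_zero fun i hi => ?_
    rw [hzero i (by simpa using hi), neg_zero, zero_div, zero_smul]
  rw [hT, one_add_diagOp_mul horth]
  refine one_add_diagOp_eq_one fun i _ => ?_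
  have : 1 + lam i ≠ 0 := by linarith [(hw.mem_Ioc i).1]
  simp only [Pi.add_apply, Pi.mul_apply]
  field_simp
  ring

omit [CompleteSpace H] in
theorem opSqrt_invSqrtApply {T : H →L[ℝ] H} {x : H} (hx : x ∈ Set.range (opSqrt T)) :
    opSqrt T (invSqrtApply T x) = x :=
  Function.invFun_eq hx

/-- Both optimal operators come from one `U`: `precOpt` is `C_pr⁻¹ + U U*` and `covOpt` is its
inverse. -/
theorem IsEigenSystem.exists_opt (hw : IsEigenSystem G Cobs Cpr lam w) (hCpr : IsStrictlyPos Cpr)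
    {m : ℕ} (h : SpectralData (opSqrt Cpr) lam w m) (r : ℕ) :
    ∃ U : EuclideanSpace ℝ (Fin r) →L[ℝ] H,
      precOpt Cpr lam w r = (toUnbdd Cpr).inverse + toUnbdd (U ∘L adjoint U) ∧
      covOpt Cpr lam w r = lowRankCov (opSqrt Cpr) U ∧
      covOpt Cpr lam w r =
        opSqrt Cpr * (1 + diagOp w m fun k => if k < r then lam k else 0) * opSqrt Cpr ∧
      opSqrt Cpr * (U ∘L adjoint U) * opSqrt Cpr =
        diagOp w m fun k => if k < r then -lam k / (1 + lam k) else 0 := by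
  obtain ⟨-, hSS⟩ := opSqrt_spec hCpr.isPositive
  have hlam : ∀ i, 0 < 1 + lam i := fun i => by linarith [(hw.mem_Ioc i).1]
  obtain ⟨U, hU⟩ := exists_comp_adjoint_eq_sum (fun i => invSqrtApply Cpr (w i))
    (c := fun i => -lam i / (1 + lam i))
    (fun i => div_nonneg (neg_nonneg.2 (hw.mem_Ioc i).2) (hlam i).le) r
  have hconj : opSqrt Cpr * (U ∘L adjoint U) * opSqrt Cpr =
      diagOp w m fun k => if k < r then -lam k / (1 + lam k) else 0 := by
    rw [hU, ← sum_range_smul_rankOne_eq_diagOp (a := fun k => -lam k / (1 + lam k))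
      (fun i hi => by rw [h.eq_zero i hi, neg_zero, zero_div]), Finset.mul_sum, Finset.sum_mul]
    refine Finset.sum_congr rfl fun i _ => ?_
    rw [mul_smul_comm, smul_mul_assoc, conj_rankOne h.isSelfAdjoint,
      opSqrt_invSqrtApply (hw.mem_range i)]
  have hcov : covOpt Cpr lam w r =
      opSqrt Cpr * (1 + diagOp w m fun k => if k < r then lam k else 0) * opSqrt Cpr := by
    rw [← sum_range_smul_rankOne_eq_diagOp h.eq_zero, mul_add, add_mul, mul_one, hSS, covOpt,
      sub_eq_add_neg, ← Finset.sum_neg_distrib, Finset.mul_sum, Finset.sum_mul]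
    congr 1
    refine Finset.sum_congr rfl fun i _ => ?_
    rw [mul_smul_comm, smul_mul_assoc, conj_rankOne h.isSelfAdjoint, neg_smul, neg_neg]
  refine ⟨U, by rw [precOpt, hU], ?_, hcov, hconj⟩
  rw [hcov]
  refine (lowRankCov_eq_of_mul_eq_one h.isSelfAdjoint ?_).symm
  rw [hconj, one_add_diagOp_mul h.orthonormal]
  refine one_add_diagOp_eq_one fun k _ => ?_
  have := (hlam k).ne'
  simp only [Pi.add_apply, Pi.mul_apply]
  split_ifs
  · field_simp
    ring
  · ring

/-- Exchanging two eigenvectors of the same nonzero eigenvalue gives another eigensystem. -/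
theorem IsEigenSystem.comp_swap (hw : IsEigenSystem G Cobs Cpr lam w) {i j : ℕ}
    (hij : lam i = lam j) (hi : lam i ≠ 0) :
    IsEigenSystem G Cobs Cpr lam (w ∘ Equiv.swap i j) := by
  have hj : lam j ≠ 0 := hij ▸ hi
  have hlam : ∀ k, lam (Equiv.swap i j k) = lam k := fun k => by
    rw [Equiv.swap_apply_def]
    split_ifs with h1 h2
    · rw [h1, hij]
    · rw [h2, hij]
    · rfl
  have hzero : ∀ k, w (Equiv.swap i j k) = 0 ↔ w k = 0 := fun k => by
    have hwi : w i ≠ 0 := fun h0 => hi (hw.pad i h0)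
    have hwj : w j ≠ 0 := fun h0 => hj (hw.pad j h0)
    rw [Equiv.swap_apply_def]
    split_ifs with h1 h2
    · rw [h1]; exact iff_of_false hwj hwi
    · rw [h2]; exact iff_of_false hwi hwj
    · rfl
  refine ⟨hw.mono, hw.mem_Ioc, ⟨?_, ?_, fun k l hkl hk => ?_⟩, fun k hk => hw.pad k ((hzero k).1 hk),
    fun k => hw.mem_range _, fun x => ?_⟩
  · exact hw.onb.orthonormal_comp (g := fun k : {k : ℕ // (w ∘ Equiv.swap i j) k ≠ 0} =>
      Equiv.swap i j k) (fun k l h => Subtype.ext ((Equiv.swap i j).injective h)) fun k => k.2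
  · rw [(Equiv.swap i j).surjective.range_comp]
    exact hw.onb.dense
  · exact (hzero l).2 (hw.onb.initial k l hkl ((hzero k).1 hk))
  · have := (Equiv.hasSum_iff (Equiv.swap i j)).2 (hw.hasSum x)
    simpa only [Function.comp_def, hlam] using this

theorem covOpt_swap_ne (hw : IsEigenSystem G Cobs Cpr lam w) (hCpr : IsStrictlyPos Cpr) {k : ℕ}
    (hk : lam k = lam (k + 1)) (h0 : lam k ≠ 0) :
    covOpt Cpr lam (w ∘ Equiv.swap k (k + 1)) (k + 1) ≠ covOpt Cpr lam w (k + 1) := by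
  intro heq
  have hSinj := injective_opSqrt hCpr.isPositive hCpr.injective
  rw [covOpt, covOpt, sub_right_inj, Finset.sum_range_succ, Finset.sum_range_succ] at heq
  have h1 : ∀ i ∈ Finset.range k, (-lam i) • InnerProductSpace.rankOne ℝ
      (opSqrt Cpr ((w ∘ Equiv.swap k (k + 1)) i)) (opSqrt Cpr ((w ∘ Equiv.swap k (k + 1)) i)) =
      (-lam i) • InnerProductSpace.rankOne ℝ (opSqrt Cpr (w i)) (opSqrt Cpr (w i)) := by
    intro i hi
    have hik := Finset.mem_range.1 hi
    rw [Function.comp_apply, Equiv.swap_apply_of_ne_of_ne (by omega) (by omega)]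
  rw [Finset.sum_congr rfl h1, add_right_inj, Function.comp_apply, Equiv.swap_apply_left] at heq
  have h2 := smul_right_injective _ (neg_ne_zero.2 h0) heq
  have hw0 : w k ≠ 0 := fun h => h0 (hw.pad k h)
  have hw1 : w (k + 1) ≠ 0 := fun h => h0 (hk.trans (hw.pad _ h))
  have h3 := congrArg (fun F : H →L[ℝ] H => F (opSqrt Cpr (w k))) h2
  simp only [InnerProductSpace.rankOne_apply, ← map_smul] at h3
  have h4 := congrArg (inner ℝ (w k)) (hSinj h3)
  rw [real_inner_smul_right, real_inner_smul_right, hw.onb.inner_eq_zero (by omega), mul_zero,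
    real_inner_self_eq_norm_sq, real_inner_self_eq_norm_sq] at h4
  have h5 : 0 < ‖opSqrt Cpr (w k)‖ :=
    norm_pos_iff.2 fun h => hw0 (hSinj (h.trans (map_zero _).symm))
  have h6 : 0 < ‖w k‖ := norm_pos_iff.2 hw0
  exact (by positivity : ‖opSqrt Cpr (w k)‖ ^ 2 * ‖w k‖ ^ 2 ≠ 0) h4.symm

end

/-! ### Minimisers -/

section
variable {H : Type*} [NormedAddCommGroup H] [InnerProductSpace ℝ H] [CompleteSpace H]
variable {n : ℕ} {G : H →L[ℝ] EuclideanSpace ℝ (Fin n)}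
  {Cobs : EuclideanSpace ℝ (Fin n) →L[ℝ] EuclideanSpace ℝ (Fin n)} {Cpr : H →L[ℝ] H}
  {lam : ℕ → ℝ} {w : ℕ → H}

theorem lowRankPrec_inverse (hCpr : IsStrictlyPos Cpr) {r : ℕ}
    (U : EuclideanSpace ℝ (Fin r) →L[ℝ] H) :
    Function.Injective (lowRankCov (opSqrt Cpr) U) ∧
    LinearMap.ker ((toUnbdd Cpr).inverse + toUnbdd (U ∘L adjoint U)).toFun = ⊥ ∧
    ((toUnbdd Cpr).inverse + toUnbdd (U ∘L adjoint U)).inverse =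
      toUnbdd (lowRankCov (opSqrt Cpr) U) ∧
    (toUnbdd (lowRankCov (opSqrt Cpr) U)).inverse =
      (toUnbdd Cpr).inverse + toUnbdd (U ∘L adjoint U) := by
  obtain ⟨hS, hSS⟩ := opSqrt_spec hCpr.isPositive
  have hu := isUnit_lowRank hS.isSelfAdjoint U
  have := precision_inverse (injective_opSqrt hCpr.isPositive hCpr.injective)
    (Ring.mul_inverse_cancel _ hu) (Ring.inverse_mul_cancel _ hu)
  rwa [hSS] at this

/-- Every element of `covClass Cpr r` is some `lowRankCov (opSqrt Cpr) U`, so that its loss is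
controlled by `SpectralData.lowRankCov_loss`. -/
theorem IsEigenSystem.covClass_loss (hw : IsEigenSystem G Cobs Cpr lam w)
    (hCobs : IsStrictlyPos Cobs) (hCpr : IsStrictlyPos Cpr) (htr : HasFiniteTrace Cpr) {r : ℕ}
    {C : H →L[ℝ] H} (hC : C ∈ covClass Cpr r) :
    C ∈ equivalentCovs (posteriorCov G Cobs Cpr) ∧
    ∀ f ∈ spectralFunctions, Summable (lossTerm f (posteriorCov G Cobs Cpr) C) ∧
      ∀ L, HasSum (fun i => f (lam (r + i))) L →
        L ≤ spectralLoss f (posteriorCov G Cobs Cpr) C ∧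
        (spectralLoss f (posteriorCov G Cobs Cpr) C ≤ L →
          (r = 0 ∨ lam (r - 1) = 0 ∨ lam (r - 1) < lam r) → C = covOpt Cpr lam w r) := by
  obtain ⟨m, h, hCpos⟩ := hw.exists_spectralData hCobs hCpr htr
  obtain ⟨U, rfl⟩ := exists_lowRankCov_of_mem_covClass h.isSelfAdjoint h.injective
    (opSqrt_spec hCpr.isPositive).2 hC
  obtain ⟨-, -, -, hcov, -⟩ := hw.exists_opt hCpr h r
  obtain ⟨h1, h2⟩ := h.lowRankCov_loss (r := r) (by simp) U hCpos
  refine ⟨h1, fun f hf => ⟨(h2 f hf).1, fun L hL => ⟨((h2 f hf).2 L hL).1, fun hle hgap => ?_⟩⟩⟩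
  rw [hcov]
  refine ((h2 f hf).2 L hL).2 hle fun k hkr hkm => ?_
  rcases hgap with h0 | h0 | h0
  · omega
  · exact (h.neg k hkm).trans_le (h0.symm.le.trans (hw.mono (Nat.sub_le r 1)))
  · exact (hw.mono (by omega : k ≤ r - 1)).trans_lt h0

/-- Inversion maps `precClass Cpr r` into `covClass Cpr r`, injectively. -/
theorem precClass_inverse (hCpr : IsStrictlyPos Cpr) {r : ℕ} {P : H →ₗ.[ℝ] H}
    (hP : P ∈ precClass Cpr r) :
    LinearMap.ker P.toFun = ⊥ ∧ P.inverse = toUnbdd (boundedInverse P) ∧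
    boundedInverse P ∈ covClass Cpr r ∧ (toUnbdd (boundedInverse P)).inverse = P := by
  obtain ⟨U, rfl⟩ := hP
  obtain ⟨hS, hSS⟩ := opSqrt_spec hCpr.isPositive
  obtain ⟨-, hker, hinv, hinv'⟩ := lowRankPrec_inverse hCpr U
  rw [boundedInverse_eq hinv]
  exact ⟨hker, hinv, lowRankCov_mem_covClass hS.isSelfAdjoint
    (injective_opSqrt hCpr.isPositive hCpr.injective) hSS U, hinv'⟩

theorem IsEigenSystem.opt (hw : IsEigenSystem G Cobs Cpr lam w)
    (hCobs : IsStrictlyPos Cobs) (hCpr : IsStrictlyPos Cpr) (htr : HasFiniteTrace Cpr) (r : ℕ) :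
    precOpt Cpr lam w r ∈ precClass Cpr r ∧ covOpt Cpr lam w r ∈ covClass Cpr r ∧
    Function.Injective (covOpt Cpr lam w r) ∧
    boundedInverse (precOpt Cpr lam w r) = covOpt Cpr lam w r ∧
    ∀ f ∈ spectralFunctions, HasSum (fun i => f (lam (r + i)))
        (spectralLoss f (posteriorCov G Cobs Cpr) (covOpt Cpr lam w r)) := by
  obtain ⟨m, h, hCpos⟩ := hw.exists_spectralData hCobs hCpr htr
  obtain ⟨U, hprec, hcov, -, hU⟩ := hw.exists_opt hCpr h r
  obtain ⟨hinj, -, hinv, -⟩ := lowRankPrec_inverse hCpr U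
  refine ⟨⟨U, hprec⟩, ?_, ?_, ?_, fun f hf => ?_⟩
  · rw [hcov]
    exact lowRankCov_mem_covClass h.isSelfAdjoint h.injective (opSqrt_spec hCpr.isPositive).2 U
  · rwa [hcov]
  · rw [hprec, hcov]
    exact boundedInverse_eq hinv
  · rw [hcov]
    exact h.hasSum_spectralLoss_opt U hCpos hU hf.2.1

theorem IsEigenSystem.minimises (hw : IsEigenSystem G Cobs Cpr lam w)
    (hCobs : IsStrictlyPos Cobs) (hCpr : IsStrictlyPos Cpr) (htr : HasFiniteTrace Cpr) (r : ℕ) :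
    SolvesPrec (posteriorCov G Cobs Cpr) (precClass Cpr r) (precOpt Cpr lam w r) ∧
    SolvesCov (posteriorCov G Cobs Cpr) (covClass Cpr r) (covOpt Cpr lam w r) := by
  obtain ⟨hP, hC, -, hinv, hsum⟩ := hw.opt hCobs hCpr htr r
  have hmin : ∀ f ∈ spectralFunctions, ∀ C ∈ covClass Cpr r,
      spectralLoss f (posteriorCov G Cobs Cpr) (covOpt Cpr lam w r) ≤
        spectralLoss f (posteriorCov G Cobs Cpr) C := fun f hf C hC =>
    (((hw.covClass_loss hCobs hCpr htr hC).2 f hf).2 _ (hsum f hf)).1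
  refine ⟨⟨hP, fun f hf => ⟨hP, isMinOn_iff.2 fun P hP' => ?_⟩⟩,
    ⟨hC, fun f hf => ⟨hC, isMinOn_iff.2 fun C hC' => hmin f hf C hC'⟩⟩⟩
  rw [hinv]
  exact hmin f hf _ (precClass_inverse hCpr hP').2.2.1

/-- Without a gap the optimal operators are not unique: the eigenvectors `w_{r-1}` and `w_r` can be
exchanged. -/
theorem IsEigenSystem.exists_other_solution (hw : IsEigenSystem G Cobs Cpr lam w)
    (hCobs : IsStrictlyPos Cobs) (hCpr : IsStrictlyPos Cpr) (htr : HasFiniteTrace Cpr) {r : ℕ}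
    (hgap : ¬(r = 0 ∨ lam (r - 1) = 0 ∨ lam (r - 1) < lam r)) :
    (∃ C, SolvesCov (posteriorCov G Cobs Cpr) (covClass Cpr r) C ∧ C ≠ covOpt Cpr lam w r) ∧
    ∃ P, SolvesPrec (posteriorCov G Cobs Cpr) (precClass Cpr r) P ∧ P ≠ precOpt Cpr lam w r := by
  push Not at hgap
  obtain ⟨hr, h0, hle⟩ := hgap
  obtain ⟨k, rfl⟩ := Nat.exists_eq_succ_of_ne_zero hr
  rw [Nat.succ_eq_add_one, Nat.add_sub_cancel] at *
  have hk : lam k = lam (k + 1) := le_antisymm (hw.mono (Nat.le_succ k)) hle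
  have hw' := hw.comp_swap hk h0
  have hne := covOpt_swap_ne hw hCpr hk h0
  obtain ⟨hP, hC⟩ := hw'.minimises hCobs hCpr htr (k + 1)
  refine ⟨⟨_, hC, hne⟩, ⟨_, hP, fun heq => hne ?_⟩⟩
  rw [← (hw.opt hCobs hCpr htr (k + 1)).2.2.2.1, ← (hw'.opt hCobs hCpr htr (k + 1)).2.2.2.1, heq]

end

end LowRankGaussian

end

theorem theorem4p12 {H : Type*} [NormedAddCommGroup H] [InnerProductSpace ℝ H] [CompleteSpace H]
    [TopologicalSpace.SeparableSpace H] {n : ℕ}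
    (G : H →L[ℝ] EuclideanSpace ℝ (Fin n))
    (Cobs : EuclideanSpace ℝ (Fin n) →L[ℝ] EuclideanSpace ℝ (Fin n)) (hCobs : IsStrictlyPos Cobs)
    (Cpr : H →L[ℝ] H) (hCpr : IsStrictlyPos Cpr) (htr : HasFiniteTrace Cpr)
    (lam : ℕ → ℝ) (w : ℕ → H) (hw : IsEigenSystem G Cobs Cpr lam w)
    (r : ℕ) (hr : r ≤ n) :
    -- the losses of all competitors are well defined and finite
    posteriorCov G Cobs Cpr ∈ equivalentCovs (posteriorCov G Cobs Cpr) ∧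
    covClass Cpr r ⊆ equivalentCovs (posteriorCov G Cobs Cpr) ∧
    (∀ C ∈ covClass Cpr r, ∀ f ∈ spectralFunctions,
      Summable (lossTerm f (posteriorCov G Cobs Cpr) C)) ∧
    (∀ P ∈ precClass Cpr r,
      LinearMap.ker P.toFun = ⊥ ∧ P.inverse = toUnbdd (boundedInverse P) ∧
      boundedInverse P ∈ equivalentCovs (posteriorCov G Cobs Cpr) ∧
      ∀ f ∈ spectralFunctions,
        Summable (lossTerm f (posteriorCov G Cobs Cpr) (boundedInverse P))) ∧
    -- both operators are optimal, for all spectral losses simultaneously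
    SolvesPrec (posteriorCov G Cobs Cpr) (precClass Cpr r) (precOpt Cpr lam w r) ∧
    SolvesCov (posteriorCov G Cobs Cpr) (covClass Cpr r) (covOpt Cpr lam w r) ∧
    -- they are inverses of each other
    Function.Injective (covOpt Cpr lam w r) ∧
    (toUnbdd (covOpt Cpr lam w r)).inverse = precOpt Cpr lam w r ∧
    LinearMap.ker (precOpt Cpr lam w r).toFun = ⊥ ∧
    (precOpt Cpr lam w r).inverse = toUnbdd (covOpt Cpr lam w r) ∧
    -- the minimal loss
    (∀ f ∈ spectralFunctions,
      HasSum (fun i => f (lam (r + i)))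
        (spectralLoss f (posteriorCov G Cobs Cpr) (covOpt Cpr lam w r))) ∧
    -- uniqueness of the simultaneous solutions
    ((∀ C, SolvesCov (posteriorCov G Cobs Cpr) (covClass Cpr r) C → C = covOpt Cpr lam w r) ↔
      (r = 0 ∨ lam (r - 1) = 0 ∨ lam (r - 1) < lam r)) ∧
    ((∀ P, SolvesPrec (posteriorCov G Cobs Cpr) (precClass Cpr r) P → P = precOpt Cpr lam w r) ↔
      (r = 0 ∨ lam (r - 1) = 0 ∨ lam (r - 1) < lam r)) ∧
    -- uniqueness of the minimisers of each single loss
    (∀ f ∈ spectralFunctions,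
      ((∀ C, MinimisesCov f (posteriorCov G Cobs Cpr) (covClass Cpr r) C →
          C = covOpt Cpr lam w r) ↔
        (r = 0 ∨ lam (r - 1) = 0 ∨ lam (r - 1) < lam r)) ∧
      ((∀ P, MinimisesPrec f (posteriorCov G Cobs Cpr) (precClass Cpr r) P →
          P = precOpt Cpr lam w r) ↔
        (r = 0 ∨ lam (r - 1) = 0 ∨ lam (r - 1) < lam r))) := by
  obtain ⟨hP, hC, hinj, hinv, hsum⟩ := hw.opt hCobs hCpr htr r
  obtain ⟨hsolP, hsolC⟩ := hw.minimises hCobs hCpr htr r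
  obtain ⟨hker, hPinv, -, hCinv⟩ := precClass_inverse hCpr hP
  rw [hinv] at hPinv hCinv
  have hloss := fun {C} hC => hw.covClass_loss hCobs hCpr htr (r := r) (C := C) hC
  have huniqC : (r = 0 ∨ lam (r - 1) = 0 ∨ lam (r - 1) < lam r) → ∀ f ∈ spectralFunctions, ∀ C,
      MinimisesCov f (posteriorCov G Cobs Cpr) (covClass Cpr r) C → C = covOpt Cpr lam w r :=
    fun hgap f hf C hmin => (((hloss hmin.1).2 f hf).2 _ (hsum f hf)).2 (hmin.2 hC) hgap
  have huniqP : (r = 0 ∨ lam (r - 1) = 0 ∨ lam (r - 1) < lam r) → ∀ f ∈ spectralFunctions, ∀ P,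
      MinimisesPrec f (posteriorCov G Cobs Cpr) (precClass Cpr r) P → P = precOpt Cpr lam w r := by
    intro hgap f hf P hmin
    obtain ⟨-, -, hmem, hPP⟩ := precClass_inverse hCpr hmin.1
    have hle := isMinOn_iff.1 hmin.2 _ hP
    rw [hinv] at hle
    rw [← hPP, (((hloss hmem).2 f hf).2 _ (hsum f hf)).2 hle hgap, hCinv]
  have hother := fun hgap => hw.exists_other_solution hCobs hCpr htr (r := r) hgap
  refine ⟨?_, fun C hC => (hloss hC).1, fun C hC f hf => ((hloss hC).2 f hf).1, fun P hP => ?_,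
    hsolP, hsolC, hinj, hCinv, hker, hPinv, hsum, ⟨fun huniq => ?_, fun hgap C hsol => ?_⟩,
    ⟨fun huniq => ?_, fun hgap P hsol => ?_⟩, fun f hf =>
      ⟨⟨fun huniq => ?_, fun hgap => huniqC hgap f hf⟩,
        ⟨fun huniq => ?_, fun hgap => huniqP hgap f hf⟩⟩⟩
  · obtain ⟨m, h, hCpos⟩ := hw.exists_spectralData hCobs hCpr htr
    rw [hCpos]
    exact mem_equivalentCovs_self h.isSelfAdjoint h.hasFiniteTrace
      (isPositive_one_add_diagOp h.orthonormal fun i _ => (hw.mem_Ioc i).1)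
  · obtain ⟨h1, h2, h3, -⟩ := precClass_inverse hCpr hP
    exact ⟨h1, h2, (hloss h3).1, fun f hf => ((hloss h3).2 f hf).1⟩
  · by_contra hgap
    obtain ⟨C, hsol, hne⟩ := (hother hgap).1
    exact hne (huniq C hsol)
  · exact huniqC hgap _ sq_mem_spectralFunctions C (hsol.2 _ sq_mem_spectralFunctions)
  · by_contra hgap
    obtain ⟨P, hsol, hne⟩ := (hother hgap).2
    exact hne (huniq P hsol)
  · exact huniqP hgap _ sq_mem_spectralFunctions P (hsol.2 _ sq_mem_spectralFunctions)
  · by_contra hgap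
    obtain ⟨C, hsol, hne⟩ := (hother hgap).1
    exact hne (huniq C (hsol.2 f hf))
  · by_contra hgap
    obtain ⟨P, hsol, hne⟩ := (hother hgap).2
    exact hne (huniq P (hsol.2 f hf))
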